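/- **Setting.** Let $n,d\in\mathbb N$, let $m_1,\dots,m_n>0$ be masses, $N=\{1,\dots,n\}$, and let $M=\{q=(q_1,\dots,q_n)\in(\mathbb R^d)^n\mid \sum_k m_kq_k=0\}$. Put $\langle q,p\rangle=\sum_i\langle q_i,p_i\rangle$, $(\mathcal M v)_i=m_iv_i$, $\|q\|_{\mathcal M}^2=\langle q,\mathcal Mq\rangle$, $\langle p,p'\rangle_{\mathcal M^{-1}}=\sum_i\frac1{m_i}\langle p_i,p_i'\rangle$. Set partitions of $N$ are ordered by refinement: $\mathcal C\preccurlyeq\mathcal D$ ("$\mathcal C$ is finer than $\mathcal D$") if each atom of $\mathcal C$ lies in an atom of $\mathcal D$. For $q\in M$ the collision partition is given by: $i,j$ lie in the same atom iff $q_i=q_j$. For $C\subseteq N$ nonempty let $m_C=\sum_{j\in C}m_j$ and $q_C=\frac1{m_C}\sum_{j\in C}m_jq_j$. For a partition $\mathcal C$, $q\mapsto q^E_{\mathcal C}$ with $(q^E_{\mathcal C})_i=q_{C}$ for the atom $C\ni i$ is the $\mathcal M$-orthogonal projection of $M$ onto $\Delta_{\mathcal C}=\{q\in M\mid q_i=q_j$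 if $i,j$ lie in the same atom of $\mathcal C\}$, and $q^I_{\mathcal C}=q-q^E_{\mathcal C}$. For a single cluster $C$, $\Pi^E_C$ is the $\mathcal M$-orthogonal projection onto $\{q\in M\mid q_i=q_j \text{ for } i,j\in C\}$ and $\Pi^I_C=\mathrm{id}-\Pi^E_C$. Let $J(q)=\frac12\|q\|_{\mathcal M}^2$, $J_C^E=J\circ\Pi_C^E$, $J_C^I=J\circ\Pi_C^I$, $J^E_{\mathcal C}(q)=J(q^E_{\mathcal C})=\sum_{C\in\mathcal C}\frac{m_C}2\|q_C\|^2$, $J^I_{\mathcal C}(q)=J(q^I_{\mathcal C})$. A *nondeterministic trajectory* is a continuous curve $q:I\to M$ on $I=(T^-,T^+)$, $-\infty\le T^-<0<T^+\le\infty$, such that 1. if $T^\pm$ is finite, $\lim_{t\to T^\pm}q(t)$ does not exist in $M$; 2. writing $\mathrm{CS}(t)$ for the collision partition of $q(t)$ and $\mathcal T$ for the set of $t\in I$ at which $\mathrm{CS}$ is not locally constant, the momentum $p=\mathcal Mq'$ exists and is constant on each interval contained in $I\setminus\mathcal T$; 3. for every $\tau\in I$ the map $t\mapsto q^E_{\mathrm{CS}(\tau)}(t)$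 is continuously differentiable in an open interval around $\tau$, and $p^E_{\mathrm{CS}(\tau)}(t):=\mathcal M\,(q^E_{\mathrm{CS}(\tau)})'(t)$ is locally constant at $\tau$. Write $q^E_{\mathrm{CS}}(t)=q^E_{\mathrm{CS}(t)}(t)$, $p^E_{\mathrm{CS}}(t)=p^E_{\mathrm{CS}(t)}(t)$, $J(t)=J(q(t))$ (and similarly for the other functions of $q$), and $\mathcal T_{\mathcal C}=\{t\in\mathcal T\mid \mathrm{CS}(t)=\mathcal C\}$. **Theorem.** For every nondeterministic trajectory $q:I\to M$: 1. For every $\tau\in I$ there is a largest open interval $U_\tau\subseteq I$ containing $\tau$ with $\mathrm{CS}(t)\preccurlyeq\mathrm{CS}(\tau)$ for all $t\in U_\tau$. 2. $J$ is convex on $I$. Moreover, for every $\tau\in I$ and every atom $C$ of $\mathrm{CS}(\tau)$, the functions $J_C^E$, $\frac{m_C}2\|q_C\|^2$ and $J_C^I$ are convex on $U_\tau$, and so are $J^E_{\mathrm{CS}(\tau)}$ and $J^I_{\mathrm{CS}(\tau)}$. 3. Every accumulation point in $I$ of $\mathcal T_{\mathcal C}$ belongs to $\mathcal T_{\mathcal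 D}$ for some $\mathcal D$ strictly coarser than $\mathcal C$. The set $\mathcal T$ is countable and nowhere dense. 4. The velocity $q'$, defined on $I\setminus\mathcal T$, is locally bounded in $I$: every $\tau\in I$ has a neighbourhood $V$ such that $\|q'\|_{\mathcal M}$ is bounded on $V\cap(I\setminus\mathcal T)$. For every compact interval $[a,b]\subseteq I$ the length of $q|_{[a,b]}$ (the supremum of the $\|\cdot\|_{\mathcal M}$-lengths of inscribed polygons) is finite. 5. $J$ is continuously differentiable on $I$, with $J'(t)=\langle q(t),p^E_{\mathrm{CS}}(t)\rangle$ for all $t\in I$. 6. $J'=\langle q^E_{\mathrm{CS}},p^E_{\mathrm{CS}}\rangle$ on $I$, and the distributional derivative of $J'$ on $I$ is the Radon measure which is absolutely continuous with respect to Lebesgue measure, with the locally integrable density $t\mapsto\langle p^E_{\mathrm{CS}}(t),p^E_{\mathrm{CS}}(t)\rangle_{\mathcal M^{-1}}$. -/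

import Mathlib

open Set Filter Topology MeasureTheory
open scoped ENNReal ContDiff

namespace NDSystem

noncomputable section

/-- Positions of `n` particles in `ℝ^d`. Only its vector space structure and its topology are used;
the norm of the theory is `massNorm` below. -/
abbrev Config (n d : ℕ) : Type := Fin n → EuclideanSpace ℝ (Fin d)

/-- Set partitions of the index set, ordered by refinement: `𝒞 ≤ 𝒟` means that `𝒞` is finer than
`𝒟`, that is, every atom of `𝒞` is contained in an atom of `𝒟`. -/
abbrev SetPartition (n : ℕ) : Type := Finpartition (Finset.univ : Finset (Fin n))

variable {n d : ℕ}

/-- The canonical pairing `⟨q, p⟩ = ∑ i, ⟨q i, p i⟩`. -/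
def pairing (q p : Config n d) : ℝ := ∑ i, inner ℝ (q i) (p i)

/-- The mass matrix `ℳ = diag (m 1, …, m n) ⊗ 1`. -/
def massMap (m : Fin n → ℝ) (v : Config n d) : Config n d := fun i => m i • v i

/-- `⟨q, r⟩_ℳ = ⟨q, ℳ r⟩`. -/
def massInner (m : Fin n → ℝ) (q r : Config n d) : ℝ := pairing q (massMap m r)

/-- `‖q‖_ℳ`. -/
def massNorm (m : Fin n → ℝ) (q : Config n d) : ℝ := Real.sqrt (massInner m q q)

/-- `⟨p, p'⟩_{ℳ⁻¹} = ∑ i, ⟨p i, p' i⟩ / m i`. -/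
def invMassInner (m : Fin n → ℝ) (p p' : Config n d) : ℝ := ∑ i, inner ℝ (p i) (p' i) / m i

/-- The center of mass configuration space `M`. -/
def comSpace (m : Fin n → ℝ) : Set (Config n d) := {q | ∑ i, m i • q i = 0}

/-- The collision subspace `Δ_𝒞` of a partition. -/
def collSubspace (m : Fin n → ℝ) (𝒞 : SetPartition n) : Set (Config n d) :=
  {q | q ∈ comSpace m ∧ ∀ i j, 𝒞.part i = 𝒞.part j → q i = q j}

/-- The collision subspace `Δ_C` of a single cluster. -/
def clusterSubspace (m : Fin n → ℝ) (C : Finset (Fin n)) : Set (Config n d) :=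
  {q | q ∈ comSpace m ∧ ∀ i ∈ C, ∀ j ∈ C, q i = q j}

/-- The atom `Ξ_𝒞 = Δ_𝒞 \ ⋃_{𝒟 strictly coarser than 𝒞} Δ_𝒟` of the partition of `M`. -/
def Xi (m : Fin n → ℝ) (𝒞 : SetPartition n) : Set (Config n d) :=
  collSubspace m 𝒞 \ ⋃ 𝒟 ∈ {𝒟 : SetPartition n | 𝒞 < 𝒟}, collSubspace m 𝒟

open Classical in
/-- The partition of the particles according to equal positions. On `M` it is the unique `𝒞` with
`q ∈ Ξ_𝒞`, see `mem_Xi_iff`. -/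
def collPartition (q : Config n d) : SetPartition n := Finpartition.ofSetoid (Setoid.ker q)

theorem part_eq_part_iff (𝒞 : SetPartition n) (i j : Fin n) :
    𝒞.part i = 𝒞.part j ↔ i ∈ 𝒞.part j :=
  (𝒞.mem_part_iff_part_eq_part (Finset.mem_univ _) (Finset.mem_univ _)).symm

theorem collPartition_part_eq_iff (q : Config n d) (i j : Fin n) :
    (collPartition q).part i = (collPartition q).part j ↔ q i = q j := by
  classical
  rw [eq_comm, part_eq_part_iff]
  simp only [collPartition]
  rw [Finpartition.mem_part_ofSetoid_iff_rel]
  rfl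

theorem le_iff_part (𝒞 𝒟 : SetPartition n) :
    𝒞 ≤ 𝒟 ↔ ∀ i j, 𝒞.part i = 𝒞.part j → 𝒟.part i = 𝒟.part j := by
  constructor
  · intro h i j hij
    obtain ⟨c, hc, hle⟩ := h (𝒞.part_mem.2 (Finset.mem_univ i))
    have hi : i ∈ c := hle (𝒞.mem_part (Finset.mem_univ i))
    have hj : j ∈ c := hle (hij ▸ 𝒞.mem_part (Finset.mem_univ j))
    rw [𝒟.part_eq_of_mem hc hi, 𝒟.part_eq_of_mem hc hj]
  · intro h b hb
    obtain ⟨i, hi⟩ := 𝒞.nonempty_of_mem_parts hb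
    refine ⟨𝒟.part i, 𝒟.part_mem.2 (Finset.mem_univ i), fun j hj => ?_⟩
    rw [← part_eq_part_iff]
    apply h
    rw [𝒞.part_eq_of_mem hb hi, 𝒞.part_eq_of_mem hb hj]

theorem mem_collSubspace_iff {m : Fin n → ℝ} {q : Config n d} (hq : q ∈ comSpace m)
    (𝒞 : SetPartition n) : q ∈ collSubspace m 𝒞 ↔ 𝒞 ≤ collPartition q := by
  simp only [collSubspace, mem_ofPred_eq, hq, true_and, le_iff_part, collPartition_part_eq_iff]

/-- For `q ∈ M`, `collPartition q` is the unique partition `𝒞` with `q ∈ Ξ_𝒞`. -/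
theorem mem_Xi_iff {m : Fin n → ℝ} {q : Config n d} (hq : q ∈ comSpace m) (𝒞 : SetPartition n) :
    q ∈ Xi m 𝒞 ↔ collPartition q = 𝒞 := by
  simp only [Xi, Set.mem_sdiff, mem_collSubspace_iff hq, mem_iUnion, mem_ofPred_eq, exists_prop,
    not_exists, not_and]
  constructor
  · rintro ⟨h1, h2⟩
    by_contra hne
    exact h2 _ (lt_of_le_of_ne h1 (Ne.symm hne)) le_rfl
  · rintro rfl
    exact ⟨le_rfl, fun 𝒟 hlt hle => absurd hlt (not_lt_of_ge hle)⟩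

/-- The cluster mass `m_C`. -/
def clusterMass (m : Fin n → ℝ) (C : Finset (Fin n)) : ℝ := ∑ j ∈ C, m j

/-- The cluster barycenter `q_C`. -/
def barycenter (m : Fin n → ℝ) (C : Finset (Fin n)) (q : Config n d) : EuclideanSpace ℝ (Fin d) :=
  (clusterMass m C)⁻¹ • ∑ j ∈ C, m j • q j

/-- `q ↦ q^E_𝒞`, the `ℳ`-orthogonal projection onto `Δ_𝒞` (see `extProj_mem`, `extProj_orthogonal`):
every particle is moved to the barycenter of its atom. -/
def extProj (m : Fin n → ℝ) (𝒞 : SetPartition n) (q : Config n d) : Config n d :=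
  fun i => barycenter m (𝒞.part i) q

/-- `q ↦ q^I_𝒞`. -/
def intProj (m : Fin n → ℝ) (𝒞 : SetPartition n) (q : Config n d) : Config n d :=
  q - extProj m 𝒞 q

open Classical in
/-- The `ℳ`-orthogonal projection onto `Δ_C` for a single cluster `C` (see `clusterExtProj_mem`,
`clusterExtProj_orthogonal`). -/
def clusterExtProj (m : Fin n → ℝ) (C : Finset (Fin n)) (q : Config n d) : Config n d :=
  fun i => if i ∈ C then barycenter m C q else q i

/-- The complementary projection for a single cluster. -/
def clusterIntProj (m : Fin n → ℝ) (C : Finset (Fin n)) (q : Config n d) : Config n d :=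
  q - clusterExtProj m C q

theorem sum_mass_smul_sub_barycenter {m : Fin n → ℝ} (hm : ∀ i, 0 < m i) (C : Finset (Fin n))
    (q : Config n d) : ∑ i ∈ C, m i • (q i - barycenter m C q) = 0 := by
  rcases C.eq_empty_or_nonempty with rfl | hC
  · simp
  have h0 : (∑ j ∈ C, m j) ≠ 0 := (Finset.sum_pos (fun i _ => hm i) hC).ne'
  simp only [smul_sub, Finset.sum_sub_distrib]
  rw [← Finset.sum_smul, barycenter, clusterMass, smul_smul, mul_inv_cancel₀ h0, one_smul, sub_self]

theorem sum_mass_inner_barycenter {m : Fin n → ℝ} (hm : ∀ i, 0 < m i) (C : Finset (Fin n))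
    (q : Config n d) (w : EuclideanSpace ℝ (Fin d)) :
    ∑ i ∈ C, m i * inner ℝ (q i - barycenter m C q) w = 0 := by
  have h := congrArg (fun x => inner ℝ x w) (sum_mass_smul_sub_barycenter hm C q)
  simpa [sum_inner, inner_smul_left] using h

theorem sum_eq_sum_atoms {E : Type*} [AddCommMonoid E] (𝒞 : SetPartition n) (f : Fin n → E) :
    ∑ i, f i = ∑ C ∈ 𝒞.parts, ∑ i ∈ C, f i := by
  conv_lhs => rw [← 𝒞.biUnion_parts]
  exact Finset.sum_biUnion fun a ha b hb hab => 𝒞.disjoint ha hb hab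

theorem massInner_eq_sum (m : Fin n → ℝ) (a r : Config n d) :
    massInner m a r = ∑ i, m i * inner ℝ (a i) (r i) := by
  simp [massInner, pairing, massMap, inner_smul_right]

theorem extProj_mem {m : Fin n → ℝ} (hm : ∀ i, 0 < m i) (𝒞 : SetPartition n) {q : Config n d}
    (hq : q ∈ comSpace m) : extProj m 𝒞 q ∈ collSubspace m 𝒞 := by
  refine ⟨?_, fun i j hij => by simp only [extProj, hij]⟩
  have h : ∑ i, m i • (q i - extProj m 𝒞 q i) = 0 := by
    rw [sum_eq_sum_atoms 𝒞]
    refine Finset.sum_eq_zero fun C hC => ?_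
    rw [← sum_mass_smul_sub_barycenter hm C q]
    exact Finset.sum_congr rfl fun i hi => by simp only [extProj, 𝒞.part_eq_of_mem hC hi]
  simp only [smul_sub, Finset.sum_sub_distrib] at h
  rw [show ∑ i, m i • q i = 0 from hq, zero_sub, neg_eq_zero] at h
  exact h

theorem extProj_orthogonal {m : Fin n → ℝ} (hm : ∀ i, 0 < m i) (𝒞 : SetPartition n)
    (q : Config n d) {r : Config n d} (hr : r ∈ collSubspace m 𝒞) :
    massInner m (intProj m 𝒞 q) r = 0 := by
  rw [massInner_eq_sum, sum_eq_sum_atoms 𝒞]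
  refine Finset.sum_eq_zero fun C hC => ?_
  obtain ⟨k, hk⟩ := 𝒞.nonempty_of_mem_parts hC
  rw [← sum_mass_inner_barycenter hm C q (r k)]
  refine Finset.sum_congr rfl fun i hi => ?_
  rw [hr.2 i k (by rw [𝒞.part_eq_of_mem hC hi, 𝒞.part_eq_of_mem hC hk])]
  simp only [intProj, extProj, Pi.sub_apply, 𝒞.part_eq_of_mem hC hi]

theorem clusterExtProj_mem {m : Fin n → ℝ} (hm : ∀ i, 0 < m i) (C : Finset (Fin n))
    {q : Config n d} (hq : q ∈ comSpace m) : clusterExtProj m C q ∈ clusterSubspace m C := by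
  classical
  refine ⟨?_, fun i hi j hj => by simp only [clusterExtProj, hi, hj, if_true]⟩
  have h : ∑ i, m i • (q i - clusterExtProj m C q i) = 0 := by
    rw [← Finset.sum_subset (Finset.subset_univ C)
      (fun i _ hi => by simp [clusterExtProj, hi]), ← sum_mass_smul_sub_barycenter hm C q]
    exact Finset.sum_congr rfl fun i hi => by simp only [clusterExtProj, hi, if_true]
  simp only [smul_sub, Finset.sum_sub_distrib] at h
  rw [show ∑ i, m i • q i = 0 from hq, zero_sub, neg_eq_zero] at h
  exact h

theorem clusterExtProj_orthogonal {m : Fin n → ℝ} (hm : ∀ i, 0 < m i) (C : Finset (Fin n))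
    (q : Config n d) {r : Config n d} (hr : r ∈ clusterSubspace m C) :
    massInner m (clusterIntProj m C q) r = 0 := by
  classical
  rw [massInner_eq_sum, ← Finset.sum_subset (Finset.subset_univ C)
      (fun i _ hi => by simp [clusterIntProj, clusterExtProj, hi])]
  rcases C.eq_empty_or_nonempty with rfl | ⟨k, hk⟩
  · simp
  rw [← sum_mass_inner_barycenter hm C q (r k)]
  refine Finset.sum_congr rfl fun i hi => ?_
  rw [hr.2 i hi k hk]
  simp only [clusterIntProj, clusterExtProj, Pi.sub_apply, hi, if_true]

/-- The scalar moment of inertia `J(q) = ½ ⟨q, q⟩_ℳ`. -/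
def inertia (m : Fin n → ℝ) (q : Config n d) : ℝ := 1 / 2 * massInner m q q

/-- The time interval `(T⁻, T⁺)`. -/
def timeInterval (Tm Tp : EReal) : Set ℝ := {t | Tm < (t : EReal) ∧ (t : EReal) < Tp}

/-- The set `𝒯` of times in `I` at which the collision partition is not locally constant. -/
def collTimes (I : Set ℝ) (q : ℝ → Config n d) : Set ℝ :=
  {t | t ∈ I ∧ ¬ ∀ᶠ s in 𝓝 t, collPartition (q s) = collPartition (q t)}

/-- The set `𝒯_𝒞` of those times in `𝒯` at which the collision partition is `𝒞`. -/
def collTimesAt (I : Set ℝ) (q : ℝ → Config n d) (𝒞 : SetPartition n) : Set ℝ :=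
  {t | t ∈ collTimes I q ∧ collPartition (q t) = 𝒞}

/-- The external momentum `p^E_𝒞(t) = ℳ (q^E_𝒞)'(t)` along a curve, for a fixed partition `𝒞`. -/
def extMomentum (m : Fin n → ℝ) (𝒞 : SetPartition n) (q : ℝ → Config n d) (t : ℝ) : Config n d :=
  massMap m (deriv (fun s => extProj m 𝒞 (q s)) t)

/-- `p^E_CS(t)`, the external momentum at time `t` for the partition `𝒞 = CS(t)`. -/
def extMomentumCS (m : Fin n → ℝ) (q : ℝ → Config n d) (t : ℝ) : Config n d :=
  extMomentum m (collPartition (q t)) q t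

/-- `q` is a nondeterministic trajectory with escape times `T⁻`, `T⁺`, for particles of masses `m`.
The curve lives on the interval `(T⁻, T⁺)`; its values at other times play no role. -/
structure IsTrajectory (m : Fin n → ℝ) (Tm Tp : EReal) (q : ℝ → Config n d) : Prop where
  neg_escape : Tm < 0
  pos_escape : 0 < Tp
  mem : ∀ t ∈ timeInterval Tm Tp, q t ∈ comSpace m
  continuousOn : ContinuousOn q (timeInterval Tm Tp)
  /-- no limit in `M` at a finite escape time in the past -/
  no_limit_neg : ∀ a : ℝ, Tm = (a : EReal) → ¬ ∃ x ∈ comSpace m, Tendsto q (𝓝[>] a) (𝓝 x)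
  /-- no limit in `M` at a finite escape time in the future -/
  no_limit_pos : ∀ b : ℝ, Tp = (b : EReal) → ¬ ∃ x ∈ comSpace m, Tendsto q (𝓝[<] b) (𝓝 x)
  /-- on each interval without collision times the momentum exists and is constant -/
  momentum_const : ∀ S : Set ℝ, S.OrdConnected →
    S ⊆ timeInterval Tm Tp \ collTimes (timeInterval Tm Tp) q →
    ∃ p : Config n d, ∀ t ∈ S, DifferentiableAt ℝ q t ∧ massMap m (deriv q t) = p
  /-- near each time `τ` the external position for `CS(τ)` is `C¹`, and its momentum is locally
  constant at `τ` -/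
  ext_momentum_const : ∀ τ ∈ timeInterval Tm Tp, ∃ a b : ℝ,
    τ ∈ Ioo a b ∧ Ioo a b ⊆ timeInterval Tm Tp ∧
    ContDiffOn ℝ 1 (fun t => extProj m (collPartition (q τ)) (q t)) (Ioo a b) ∧
    ∀ᶠ t in 𝓝 τ,
      extMomentum m (collPartition (q τ)) q t = extMomentum m (collPartition (q τ)) q τ

/-- The open intervals `U ⊆ I` containing `τ` on which the collision partition is finer than
(or equal to) the one at time `τ`. -/
def finerIntervals (I : Set ℝ) (q : ℝ → Config n d) (τ : ℝ) : Set (Set ℝ) :=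
  {U | IsOpen U ∧ U.OrdConnected ∧ τ ∈ U ∧ U ⊆ I ∧
    ∀ t ∈ U, collPartition (q t) ≤ collPartition (q τ)}

/-- The length of the curve `q` on `[a, b]` with respect to `‖·‖_ℳ`, as the supremum of the lengths
of the inscribed polygons for `a = t 0 < … < t k = b`. -/
def curveLength (m : Fin n → ℝ) (q : ℝ → Config n d) (a b : ℝ) : ℝ≥0∞ :=
  ⨆ (k : ℕ) (t : Fin (k + 1) → ℝ) (_ : StrictMono t ∧ t 0 = a ∧ t (Fin.last k) = b),
    ∑ j : Fin k, ENNReal.ofReal (massNorm m (q (t j.succ) - q (t j.castSucc)))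

/-- The distributional derivative of the locally integrable function `f` on the open set `I` is the
Radon measure `μ` on `I`: `μ` is finite on compact subsets of `I`, and
`∫ φ dμ = - ∫ f φ' dt` for all test functions `φ ∈ C_c^∞(I)`. -/
def HasDistribDerivMeasure (I : Set ℝ) (f : ℝ → ℝ) (μ : Measure ℝ) : Prop :=
  LocallyIntegrableOn f I volume ∧ (∀ K ⊆ I, IsCompact K → μ K < ⊤) ∧
    ∀ φ : ℝ → ℝ, ContDiff ℝ ∞ φ → HasCompactSupport φ → tsupport φ ⊆ I →
      ∫ t, φ t ∂μ = - ∫ t in I, f t * deriv φ t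

end

end NDSystem

open NDSystem

/-! Near a time `τ` the trajectory itself may be wild, but its external part for `CS(τ)` is affine:
it equals `q τ + (t - τ) • v`, since its derivative is locally constant and the projection fixes `q
τ`. Let `F` be a convex function on configurations that does not increase under this projection.
Convexity gives `2 F(q τ) ≤ F(q τ + s v) + F(q τ - s v)`, and the right side is at most `F(q (τ +
s)) + F(q (τ - s))`. Midpoint convexity at small scales around every point suffices for a continuous
function, so `F ∘ q` is convex (`IsTrajectory.convexOn_comp`).

By Jensen on each atom, `x ↦ ∑ m_i φ((L x)_i)` is such an `F` whenever `φ` is convex and `L`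
commutes with the projections that occur. The choices of `φ` and `L` yield the rest.

With `φ = ½‖·‖²`, `J` and its cluster parts are convex. Where `CS ≤ 𝒞`, the nonnegative convex
function `J^I_𝒞` vanishes exactly when `CS = 𝒞`, so those times form an interval whose interior
avoids `𝒯`. This forces accumulation points of `𝒯_𝒞` to have strictly coarser partitions. Each `𝒯_𝒞`
is then discrete, hence countable.

With `φ = ‖· - q_i(τ)‖`, a velocity `v_i` produces a kink at `τ`, whose size convexity bounds in
terms of a bound on the positions (`IsTrajectory.exists_extVelocity_bound`). As `𝒯` is countable,
bounded velocity makes `q` locally Lipschitz. Hence `J^I_{CS(τ)}` is quadratically small at `τ`, and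
`J'(τ)` comes from the external part alone. A differentiable convex function on an open interval is
`C¹`. Finally `J'` is continuous and is locally affine off the countable set `𝒯`, so integration by
parts leaves no singular part in its distributional derivative. -/

namespace NDSystem

/-! ### Convexity from local midpoint inequalities -/

/-- A continuous function on an interval that is midpoint convex at all sufficiently small
scales around each point is convex. -/
theorem convexOn_of_eventually_midpoint {S : Set ℝ} (hS : S.OrdConnected)
    {f : ℝ → ℝ} (hf : ContinuousOn f S)
    (h : ∀ x ∈ S, ∀ᶠ s in 𝓝[>] (0 : ℝ), 2 * f x ≤ f (x + s) + f (x - s)) : ConvexOn ℝ S f := by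
  refine LinearOrder.convexOn_of_lt hS.convex fun x hx y hy hxy a b ha hb hab => ?_
  have hyx : 0 < y - x := sub_pos.2 hxy
  -- Subtracting the secant preserves second differences and makes the endpoint values zero, so it
  -- remains to exclude a positive maximum.
  set k := (f y - f x) / (y - x) with hk
  set g : ℝ → ℝ := fun t => f t - (f x + (t - x) * k) with hg
  have hsub : Icc x y ⊆ S := hS.out hx hy
  have hgc : ContinuousOn g (Icc x y) := by
    refine (hf.mono hsub).sub ?_
    fun_prop
  have hgx : g x = 0 := by simp [hg]
  have hgy : g y = 0 := by
    simp only [hg, hk]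
    field_simp
    ring
  have hle : ∀ t ∈ Icc x y, g t ≤ 0 := by
    obtain ⟨t₁, ht₁, hmax⟩ := isCompact_Icc.exists_isMaxOn ⟨x, left_mem_Icc.2 hxy.le⟩ hgc
    have hmax' : ∀ t ∈ Icc x y, g t ≤ g t₁ := fun t ht => hmax ht
    by_contra hcon
    push Not at hcon
    obtain ⟨t₂, ht₂, hpos⟩ := hcon
    have hpos' : 0 < g t₁ := hpos.trans_le (hmax' t₂ ht₂)
    have hZ : IsCompact (Icc x y ∩ g ⁻¹' {g t₁}) :=
      isCompact_Icc.of_isClosed_subset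
        (hgc.preimage_isClosed_of_isClosed isClosed_Icc isClosed_singleton) inter_subset_left
    -- At the leftmost maximum, the midpoint inequality forces `g (t₀ - s)` to be maximal too,
    -- contradicting leftmostness.
    obtain ⟨t₀, ⟨ht₀, hgt₀⟩, hleast⟩ := hZ.exists_isLeast ⟨t₁, ht₁, rfl⟩
    have hgt₀' : g t₀ = g t₁ := hgt₀
    have h1 : x < t₀ := lt_of_le_of_ne ht₀.1 fun e => by
      rw [← e, hgx] at hgt₀'; exact hpos'.ne hgt₀'
    have h2 : t₀ < y := lt_of_le_of_ne ht₀.2 fun e => by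
      rw [e, hgy] at hgt₀'; exact hpos'.ne hgt₀'
    have e1 : ∀ᶠ s in 𝓝[>] (0 : ℝ), s < min (t₀ - x) (y - t₀) :=
      (eventually_lt_nhds (lt_min (sub_pos.2 h1) (sub_pos.2 h2))).filter_mono nhdsWithin_le_nhds
    obtain ⟨s, hs, hs1, hs0⟩ := ((h t₀ (hsub ht₀)).and (e1.and self_mem_nhdsWithin)).exists
    have hs0' : 0 < s := hs0
    have hsx := hs1.trans_le (min_le_left _ _)
    have hsy := hs1.trans_le (min_le_right _ _)
    have hmem : t₀ - s ∈ Icc x y := ⟨by linarith, by linarith⟩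
    have b1 := hmax' (t₀ + s) ⟨by linarith, by linarith⟩
    have b2 := hmax' (t₀ - s) hmem
    have b3 : 2 * g t₀ ≤ g (t₀ + s) + g (t₀ - s) := by
      simp only [hg]; linarith
    have := hleast ⟨hmem, show g (t₀ - s) = g t₁ by linarith⟩
    linarith
  have hz := hle (a * x + b * y)
    (convex_Icc x y (left_mem_Icc.2 hxy.le) (right_mem_Icc.2 hxy.le) ha.le hb.le hab)
  simp only [hg] at hz
  have e : a * x + b * y - x = b * (y - x) := by
    rw [show a = 1 - b by linarith]; ring
  rw [e, hk, mul_assoc, mul_div_cancel₀ _ hyx.ne'] at hz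
  simp only [smul_eq_mul]
  rw [show a = 1 - b by linarith] at hz ⊢
  linarith

/-! ### Algebra of the barycentric projections -/

variable {n d : ℕ}

theorem barycenter_add (m : Fin n → ℝ) (C : Finset (Fin n)) (x y : Config n d) :
    barycenter m C (x + y) = barycenter m C x + barycenter m C y := by
  simp [barycenter, Finset.sum_add_distrib]

theorem barycenter_smul (m : Fin n → ℝ) (C : Finset (Fin n)) (c : ℝ) (x : Config n d) :
    barycenter m C (c • x) = c • barycenter m C x := by
  simp only [barycenter, Pi.smul_apply, Finset.smul_sum]
  exact Finset.sum_congr rfl fun i _ => by module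

/-- `extProj` as a linear map. -/
noncomputable def extProjLinear (m : Fin n → ℝ) (𝒞 : SetPartition n) :
    Config n d →ₗ[ℝ] Config n d where
  toFun := extProj m 𝒞
  map_add' x y := funext fun _ => barycenter_add m _ x y
  map_smul' c x := funext fun _ => barycenter_smul m _ c x

/-- `barycenter` as a linear map. -/
noncomputable def barycenterLinear (m : Fin n → ℝ) (C : Finset (Fin n)) :
    Config n d →ₗ[ℝ] EuclideanSpace ℝ (Fin d) where
  toFun := barycenter m C
  map_add' := barycenter_add m C
  map_smul' := barycenter_smul m C

/-- `clusterExtProj` as a linear map. -/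
noncomputable def clusterExtProjLinear (m : Fin n → ℝ) (C : Finset (Fin n)) :
    Config n d →ₗ[ℝ] Config n d where
  toFun := clusterExtProj m C
  map_add' x y := by
    ext1 i
    by_cases h : i ∈ C <;> simp [clusterExtProj, h, barycenter_add]
  map_smul' c x := by
    ext1 i
    by_cases h : i ∈ C <;> simp [clusterExtProj, h, barycenter_smul]

/-- The hypothesis makes `C` a union of atoms of `𝒟`, and averaging over an atom preserves its
weighted sum. -/
theorem sum_mass_smul_extProj {m : Fin n → ℝ} (hm : ∀ i, 0 < m i) {𝒟 : SetPartition n}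
    {C : Finset (Fin n)} (hC : ∀ i j, 𝒟.part i = 𝒟.part j → i ∈ C → j ∈ C) (x : Config n d) :
    ∑ j ∈ C, m j • extProj m 𝒟 x j = ∑ j ∈ C, m j • x j := by
  classical
  rw [← sub_eq_zero, ← neg_eq_zero, neg_sub, ← Finset.sum_sub_distrib]
  rw [← Finset.univ_inter C, ← Finset.sum_ite_mem, sum_eq_sum_atoms 𝒟]
  refine Finset.sum_eq_zero fun D hD => ?_
  obtain ⟨k, hk⟩ := 𝒟.nonempty_of_mem_parts hD
  have hpart : ∀ i ∈ D, 𝒟.part i = D := fun i hi => 𝒟.part_eq_of_mem hD hi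
  by_cases hkC : k ∈ C
  · rw [← sum_mass_smul_sub_barycenter hm D x]
    refine Finset.sum_congr rfl fun i hi => ?_
    rw [if_pos (hC k i ((hpart k hk).trans (hpart i hi).symm) hkC), smul_sub]
    simp only [extProj, hpart i hi]
  · refine Finset.sum_eq_zero fun i hi => if_neg fun hiC => hkC ?_
    exact hC i k ((hpart i hi).trans (hpart k hk).symm) hiC

theorem barycenter_extProj {m : Fin n → ℝ} (hm : ∀ i, 0 < m i) {𝒟 : SetPartition n}
    {C : Finset (Fin n)} (hC : ∀ i j, 𝒟.part i = 𝒟.part j → i ∈ C → j ∈ C) (x : Config n d) :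
    barycenter m C (extProj m 𝒟 x) = barycenter m C x := by
  rw [barycenter, barycenter, sum_mass_smul_extProj hm hC]

theorem barycenter_eq_of_const {m : Fin n → ℝ} (hm : ∀ i, 0 < m i) {C : Finset (Fin n)} {i : Fin n}
    (hi : i ∈ C) {x : Config n d} (h : ∀ j ∈ C, x j = x i) : barycenter m C x = x i := by
  have h0 : (∑ j ∈ C, m j) ≠ 0 := (Finset.sum_pos (fun i _ => hm i) ⟨i, hi⟩).ne'
  have hs : ∑ j ∈ C, m j • x j = ∑ j ∈ C, m j • x i :=
    Finset.sum_congr rfl fun j hj => by rw [h j hj]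
  rw [barycenter, clusterMass, hs, ← Finset.sum_smul, smul_smul, inv_mul_cancel₀ h0, one_smul]

theorem extProj_eq_self {m : Fin n → ℝ} (hm : ∀ i, 0 < m i) {𝒟 : SetPartition n} {x : Config n d}
    (h : 𝒟 ≤ collPartition x) : extProj m 𝒟 x = x := by
  funext i
  refine barycenter_eq_of_const hm (𝒟.mem_part (Finset.mem_univ i)) fun j hj => ?_
  rw [← part_eq_part_iff] at hj
  exact (collPartition_part_eq_iff x j i).1 ((le_iff_part _ _).1 h j i hj)

/-- Converse of `extProj_eq_self`: it recovers the partition once an internal part is known to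
vanish. -/
theorem le_collPartition_of_extProj_eq_self {m : Fin n → ℝ} {𝒟 : SetPartition n} {x : Config n d}
    (h : extProj m 𝒟 x = x) : 𝒟 ≤ collPartition x := by
  rw [le_iff_part]
  intro i j hij
  rw [collPartition_part_eq_iff, ← h]
  simp only [extProj, hij]

theorem mem_of_mem_parts_of_le {𝒞 𝒟 : SetPartition n} (h : 𝒟 ≤ 𝒞) {C : Finset (Fin n)}
    (hC : C ∈ 𝒞.parts) (i j : Fin n) (hij : 𝒟.part i = 𝒟.part j) (hi : i ∈ C) : j ∈ C := by
  rw [← 𝒞.part_eq_of_mem hC hi, ← part_eq_part_iff]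
  exact ((le_iff_part _ _).1 h i j hij).symm

theorem extProj_extProj_of_le {m : Fin n → ℝ} (hm : ∀ i, 0 < m i) {𝒞 𝒟 : SetPartition n}
    (h : 𝒟 ≤ 𝒞) (x : Config n d) : extProj m 𝒞 (extProj m 𝒟 x) = extProj m 𝒞 x :=
  funext fun i => barycenter_extProj hm
    (mem_of_mem_parts_of_le h (𝒞.part_mem.2 (Finset.mem_univ i))) x

theorem extProj_extProj_of_ge {m : Fin n → ℝ} (hm : ∀ i, 0 < m i) {𝒞 𝒟 : SetPartition n}
    (h : 𝒟 ≤ 𝒞) (x : Config n d) : extProj m 𝒟 (extProj m 𝒞 x) = extProj m 𝒞 x := by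
  refine extProj_eq_self hm ((le_iff_part _ _).2 fun i j hij => ?_)
  rw [collPartition_part_eq_iff]
  simp only [extProj, (le_iff_part _ _).1 h i j hij]

/-- On `C`, a union of atoms of `𝒟`, both orders give the barycenter of `C`; the remaining atoms are
disjoint from `C`, and there the cluster projection is the identity. -/
theorem clusterExtProj_extProj {m : Fin n → ℝ} (hm : ∀ i, 0 < m i) {𝒟 : SetPartition n}
    {C : Finset (Fin n)} (hC : ∀ i j, 𝒟.part i = 𝒟.part j → i ∈ C → j ∈ C) (x : Config n d) :
    clusterExtProj m C (extProj m 𝒟 x) = extProj m 𝒟 (clusterExtProj m C x) := by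
  funext i
  have hpart : ∀ j ∈ 𝒟.part i, 𝒟.part j = 𝒟.part i := fun j hj => (part_eq_part_iff 𝒟 j i).2 hj
  by_cases hi : i ∈ C
  · have hmem : ∀ j ∈ 𝒟.part i, j ∈ C := fun j hj => hC i j (hpart j hj).symm hi
    have h1 : clusterExtProj m C x i = barycenter m C x := by simp [clusterExtProj, hi]
    rw [show extProj m 𝒟 (clusterExtProj m C x) i = clusterExtProj m C x i from
      barycenter_eq_of_const hm (𝒟.mem_part (Finset.mem_univ i)) fun j hj => by
        simp [clusterExtProj, hi, hmem j hj], h1]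
    simp [clusterExtProj, hi, barycenter_extProj hm hC]
  · have hmem : ∀ j ∈ 𝒟.part i, j ∉ C := fun j hj hjC => hi (hC j i (hpart j hj) hjC)
    simp only [clusterExtProj, hi, if_false, extProj, barycenter]
    congr 1
    exact Finset.sum_congr rfl fun j hj => by rw [if_neg (hmem j hj)]

/-! ### Convex functions of configurations -/

/-- Jensen's inequality on each atom. -/
theorem sum_mass_convex_extProj_le {m : Fin n → ℝ} (hm : ∀ i, 0 < m i) (𝒟 : SetPartition n)
    {φ : EuclideanSpace ℝ (Fin d) → ℝ} (hφ : ConvexOn ℝ univ φ) (x : Config n d) :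
    ∑ i, m i * φ (extProj m 𝒟 x i) ≤ ∑ i, m i * φ (x i) := by
  rw [sum_eq_sum_atoms 𝒟, sum_eq_sum_atoms 𝒟 fun i => m i * φ (x i)]
  refine Finset.sum_le_sum fun D hD => ?_
  have hpos : 0 < ∑ i ∈ D, m i := Finset.sum_pos (fun i _ => hm i) (𝒟.nonempty_of_mem_parts hD)
  have h := hφ.map_centerMass_le (t := D) (w := m) (p := x) (fun i _ => (hm i).le) hpos
    fun i _ => mem_univ _
  rw [Finset.centerMass, Finset.centerMass, smul_eq_mul, inv_mul_eq_div, le_div_iff₀ hpos,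
    mul_comm, Finset.sum_mul] at h
  convert h using 1
  · exact Finset.sum_congr rfl fun i hi => by
      simp only [extProj, 𝒟.part_eq_of_mem hD hi, barycenter, clusterMass]
  · rfl

theorem inertia_eq_sum (m : Fin n → ℝ) (x : Config n d) :
    inertia m x = ∑ i, m i * (1 / 2 * ‖x i‖ ^ 2) := by
  rw [inertia, massInner_eq_sum, Finset.mul_sum]
  refine Finset.sum_congr rfl fun i _ => ?_
  rw [real_inner_self_eq_norm_sq]
  ring

theorem convexOn_half_norm_sq :
    ConvexOn ℝ univ fun v : EuclideanSpace ℝ (Fin d) => 1 / 2 * ‖v‖ ^ 2 := by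
  have h := (convexOn_univ_norm (E := EuclideanSpace ℝ (Fin d))).pow (fun _ _ => norm_nonneg _) 2
  exact h.smul (by norm_num : (0 : ℝ) ≤ 1 / 2)

theorem convexOn_sum_mass {m : Fin n → ℝ} (hm : ∀ i, 0 < m i)
    {φ : EuclideanSpace ℝ (Fin d) → ℝ} (hφ : ConvexOn ℝ univ φ) :
    ConvexOn ℝ univ fun x : Config n d => ∑ i, m i * φ (x i) := by
  refine ⟨convex_univ, fun x _ y _ a b ha hb hab => ?_⟩
  simp only [smul_eq_mul, Finset.mul_sum, ← Finset.sum_add_distrib]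
  refine Finset.sum_le_sum fun i _ => ?_
  have := hφ.2 (mem_univ (x i)) (mem_univ (y i)) ha hb hab
  have := mul_le_mul_of_nonneg_left this (hm i).le
  simp only [smul_eq_mul] at this
  simp only [Pi.add_apply, Pi.smul_apply]
  linarith

/-! ### Local structure of a trajectory -/

theorem isOpen_timeInterval (Tm Tp : EReal) : IsOpen (timeInterval Tm Tp) :=
  (isOpen_Ioo (a := Tm) (b := Tp)).preimage continuous_coe_real_ereal

theorem ordConnected_timeInterval (Tm Tp : EReal) : (timeInterval Tm Tp).OrdConnected :=
  ⟨fun _ hx _ hy _ hz => ⟨hx.1.trans_le (EReal.coe_le_coe_iff.2 hz.1),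
    (EReal.coe_le_coe_iff.2 hz.2).trans_lt hy.2⟩⟩

/-- The collision partition is upper semicontinuous. -/
theorem eventually_collPartition_le (x : Config n d) :
    ∀ᶠ y in 𝓝 x, collPartition y ≤ collPartition x := by
  have h : ∀ᶠ y in 𝓝 x, ∀ i j, x i ≠ x j → y i ≠ y j := by
    refine eventually_all.2 fun i => eventually_all.2 fun j => ?_
    by_cases hij : x i = x j
    · exact Eventually.of_forall fun _ h => absurd hij h
    · have ho : IsOpen {y : Config n d | y i ≠ y j} :=
        isOpen_ne_fun (continuous_apply i) (continuous_apply j)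
      filter_upwards [ho.mem_nhds hij] with y hy _ using hy
  filter_upwards [h] with y hy
  rw [le_iff_part]
  intro i j
  rw [collPartition_part_eq_iff, collPartition_part_eq_iff]
  exact not_imp_not.1 (hy i j)

/-- The velocity of the external position for `CS(t)` at time `t`. -/
noncomputable def extVelocity (m : Fin n → ℝ) (q : ℝ → Config n d) (t : ℝ) : Config n d :=
  deriv (fun s => extProj m (collPartition (q t)) (q s)) t

theorem extMomentumCS_eq (m : Fin n → ℝ) (q : ℝ → Config n d) (t : ℝ) :
    extMomentumCS m q t = massMap m (extVelocity m q t) := rfl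

theorem massMap_injective {m : Fin n → ℝ} (hm : ∀ i, 0 < m i) :
    Function.Injective (massMap (d := d) m) := fun x y h => funext fun i => by
  have := congrFun h i
  simpa [massMap, (hm i).ne'] using this

variable {m : Fin n → ℝ} {Tm Tp : EReal} {q : ℝ → Config n d}

theorem IsTrajectory.continuousAt (hq : IsTrajectory m Tm Tp q) {τ : ℝ}
    (hτ : τ ∈ timeInterval Tm Tp) : ContinuousAt q τ :=
  hq.continuousOn.continuousAt ((isOpen_timeInterval Tm Tp).mem_nhds hτ)

theorem IsTrajectory.eventually_le (hq : IsTrajectory m Tm Tp q) {τ : ℝ}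
    (hτ : τ ∈ timeInterval Tm Tp) :
    ∀ᶠ t in 𝓝 τ, collPartition (q t) ≤ collPartition (q τ) :=
  (hq.continuousAt hτ).eventually (eventually_collPartition_le (q τ))

/-- The mass matrix is injective, so locally constant momentum means locally constant velocity; the
affine function starts at `q τ` because `CS(τ)` fixes `q τ`. This is how the dynamics enters every
later estimate. -/
theorem IsTrajectory.eventually_extProj_eq (hm : ∀ i, 0 < m i) (hq : IsTrajectory m Tm Tp q)
    {τ : ℝ} (hτ : τ ∈ timeInterval Tm Tp) :
    ∀ᶠ t in 𝓝 τ,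
      extProj m (collPartition (q τ)) (q t) = q τ + (t - τ) • extVelocity m q τ := by
  obtain ⟨a, b, hab, -, hC, hev⟩ := hq.ext_momentum_const τ hτ
  obtain ⟨ε, hε, hball⟩ := Metric.eventually_nhds_iff_ball.1 (hev.and (Ioo_mem_nhds hab.1 hab.2))
  set f := fun t => extProj m (collPartition (q τ)) (q t) with hf
  have hd : ∀ t ∈ Metric.ball τ ε, HasDerivAt f (extVelocity m q τ) t := fun t ht => by
    have h1 := ((hC.differentiableOn one_ne_zero).differentiableAt
      (isOpen_Ioo.mem_nhds (hball t ht).2)).hasDerivAt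
    rwa [show deriv f t = extVelocity m q τ from massMap_injective hm (hball t ht).1] at h1
  have hg : ∀ t ∈ Metric.ball τ ε,
      HasDerivAt (fun t => f t - (t - τ) • extVelocity m q τ) 0 t := fun t ht => by
    have := (hd t ht).sub (((hasDerivAt_id t).sub_const τ).smul_const (extVelocity m q τ))
    rw [one_smul, sub_self] at this
    exact this
  filter_upwards [Metric.ball_mem_nhds τ hε] with t ht
  have h := Metric.isOpen_ball.is_const_of_deriv_eq_zero
    (convex_ball τ ε).isPreconnected
    (fun t ht => (hg t ht).differentiableAt.differentiableWithinAt)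
    (fun t ht => (hg t ht).deriv) ht (Metric.mem_ball_self hε)
  simp only [sub_self, zero_smul, sub_zero] at h
  rw [show f τ = q τ from extProj_eq_self hm le_rfl] at h
  exact sub_eq_iff_eq_add.1 h

/-! ### Convexity along trajectories -/

/-- The main convexity criterion: a convex function that does not increase under the external
projections is convex along the trajectory. -/
theorem IsTrajectory.convexOn_comp (hm : ∀ i, 0 < m i) (hq : IsTrajectory m Tm Tp q) {S : Set ℝ}
    (hS : S.OrdConnected) (hSI : S ⊆ timeInterval Tm Tp) {F : Config n d → ℝ}
    (hF : ConvexOn ℝ univ F)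
    (hle : ∀ σ ∈ S, ∀ x, F (extProj m (collPartition (q σ)) x) ≤ F x) :
    ConvexOn ℝ S fun t => F (q t) := by
  refine convexOn_of_eventually_midpoint hS
    (hF.locallyLipschitz.continuous.comp_continuousOn (hq.continuousOn.mono hSI)) fun σ hσ => ?_
  have hev := hq.eventually_extProj_eq hm (hSI hσ)
  have t1 : Tendsto (fun s : ℝ => σ + s) (𝓝[>] 0) (𝓝 σ) := by
    have : Tendsto (fun s : ℝ => σ + s) (𝓝 0) (𝓝 (σ + 0)) := (continuous_const_add σ).tendsto 0
    rw [add_zero] at this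
    exact this.mono_left nhdsWithin_le_nhds
  have t2 : Tendsto (fun s : ℝ => σ - s) (𝓝[>] 0) (𝓝 σ) := by
    have : Tendsto (fun s : ℝ => σ - s) (𝓝 0) (𝓝 (σ - 0)) := (continuous_sub_left σ).tendsto 0
    rw [sub_zero] at this
    exact this.mono_left nhdsWithin_le_nhds
  filter_upwards [t1.eventually hev, t2.eventually hev] with s h1 h2
  have b1 := hle σ hσ (q (σ + s))
  have b2 := hle σ hσ (q (σ - s))
  rw [h1] at b1
  rw [h2] at b2
  have h := hF.2 (mem_univ (q σ + (σ + s - σ) • extVelocity m q σ))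
    (mem_univ (q σ + (σ - s - σ) • extVelocity m q σ))
    (by norm_num : (0 : ℝ) ≤ 1 / 2) (by norm_num : (0 : ℝ) ≤ 1 / 2) (by norm_num)
  rw [show (1 / 2 : ℝ) • (q σ + (σ + s - σ) • extVelocity m q σ) +
    (1 / 2 : ℝ) • (q σ + (σ - s - σ) • extVelocity m q σ) = q σ by module] at h
  simp only [smul_eq_mul] at h
  linarith

/-- Commutation with `L` moves the projection next to `φ`, where Jensen applies. -/
theorem IsTrajectory.convexOn_sum_mass (hm : ∀ i, 0 < m i) (hq : IsTrajectory m Tm Tp q)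
    {S : Set ℝ} (hS : S.OrdConnected) (hSI : S ⊆ timeInterval Tm Tp)
    {φ : EuclideanSpace ℝ (Fin d) → ℝ} (hφ : ConvexOn ℝ univ φ) (L : Config n d →ₗ[ℝ] Config n d)
    (hL : ∀ σ ∈ S, ∀ x, L (extProj m (collPartition (q σ)) x) =
      extProj m (collPartition (q σ)) (L x)) :
    ConvexOn ℝ S fun t => ∑ i, m i * φ (L (q t) i) :=
  hq.convexOn_comp hm hS hSI (F := fun x => ∑ i, m i * φ (L x i))
    ((NDSystem.convexOn_sum_mass hm hφ).comp_linearMap L) fun σ hσ x => by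
      simp only [hL σ hσ x]
      exact sum_mass_convex_extProj_le hm _ hφ (L x)

theorem IsTrajectory.convexOn_inertia (hm : ∀ i, 0 < m i) (hq : IsTrajectory m Tm Tp q)
    {S : Set ℝ} (hS : S.OrdConnected) (hSI : S ⊆ timeInterval Tm Tp)
    (L : Config n d →ₗ[ℝ] Config n d)
    (hL : ∀ σ ∈ S, ∀ x, L (extProj m (collPartition (q σ)) x) =
      extProj m (collPartition (q σ)) (L x)) :
    ConvexOn ℝ S fun t => inertia m (L (q t)) := by
  simp only [inertia_eq_sum]
  exact hq.convexOn_sum_mass hm hS hSI convexOn_half_norm_sq L hL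

/-- `intProj` as a linear map. -/
noncomputable def intProjLinear (m : Fin n → ℝ) (𝒞 : SetPartition n) :
    Config n d →ₗ[ℝ] Config n d := LinearMap.id - extProjLinear m 𝒞

theorem intProj_extProj {m : Fin n → ℝ} (hm : ∀ i, 0 < m i) {𝒞 𝒟 : SetPartition n} (h : 𝒟 ≤ 𝒞)
    (x : Config n d) : intProj m 𝒞 (extProj m 𝒟 x) = extProj m 𝒟 (intProj m 𝒞 x) := by
  have := (extProjLinear (d := d) m 𝒟).map_sub x (extProj m 𝒞 x)
  change extProj m 𝒟 (x - extProj m 𝒞 x) = extProj m 𝒟 x - extProj m 𝒟 (extProj m 𝒞 x) at this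
  rw [intProj, intProj, this, extProj_extProj_of_le hm h, extProj_extProj_of_ge hm h]

/-- `clusterIntProj` as a linear map. -/
noncomputable def clusterIntProjLinear (m : Fin n → ℝ) (C : Finset (Fin n)) :
    Config n d →ₗ[ℝ] Config n d := LinearMap.id - clusterExtProjLinear m C

theorem clusterIntProj_extProj {m : Fin n → ℝ} (hm : ∀ i, 0 < m i) {𝒟 : SetPartition n}
    {C : Finset (Fin n)} (hC : ∀ i j, 𝒟.part i = 𝒟.part j → i ∈ C → j ∈ C) (x : Config n d) :
    clusterIntProj m C (extProj m 𝒟 x) = extProj m 𝒟 (clusterIntProj m C x) := by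
  have := (extProjLinear (d := d) m 𝒟).map_sub x (clusterExtProj m C x)
  change extProj m 𝒟 (x - clusterExtProj m C x) =
    extProj m 𝒟 x - extProj m 𝒟 (clusterExtProj m C x) at this
  rw [clusterIntProj, clusterIntProj, this, clusterExtProj_extProj hm hC]

/-- Refinement makes `C` a union of atoms of `CS(t)` at every time in `S`, so both cluster
projections commute with the external ones, and the barycenter of `C` is invariant under them. -/
theorem IsTrajectory.convexOn_cluster (hm : ∀ i, 0 < m i) (hq : IsTrajectory m Tm Tp q)
    {S : Set ℝ} (hS : S.OrdConnected) (hSI : S ⊆ timeInterval Tm Tp) {𝒞 : SetPartition n}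
    (hle : ∀ t ∈ S, collPartition (q t) ≤ 𝒞) {C : Finset (Fin n)} (hC : C ∈ 𝒞.parts) :
    ConvexOn ℝ S (fun t => inertia m (clusterExtProj m C (q t))) ∧
    ConvexOn ℝ S (fun t => clusterMass m C / 2 * ‖barycenter m C (q t)‖ ^ 2) ∧
    ConvexOn ℝ S (fun t => inertia m (clusterIntProj m C (q t))) := by
  refine ⟨hq.convexOn_inertia hm hS hSI (clusterExtProjLinear m C) fun σ hσ x =>
      clusterExtProj_extProj hm (mem_of_mem_parts_of_le (hle σ hσ) hC) x, ?_,
    hq.convexOn_inertia hm hS hSI (clusterIntProjLinear m C) fun σ hσ x =>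
      clusterIntProj_extProj hm (mem_of_mem_parts_of_le (hle σ hσ) hC) x⟩
  have hmass : 0 ≤ clusterMass m C := Finset.sum_nonneg fun i _ => (hm i).le
  have hF : ConvexOn ℝ univ fun x : Config n d => clusterMass m C / 2 * ‖barycenter m C x‖ ^ 2 := by
    have := (convexOn_half_norm_sq.comp_linearMap (barycenterLinear (d := d) m C)).smul hmass
    refine this.congr fun x _ => ?_
    simp only [Function.comp_apply, smul_eq_mul]
    change clusterMass m C * (1 / 2 * ‖barycenter m C x‖ ^ 2) = _
    ring
  refine hq.convexOn_comp hm hS hSI hF fun σ hσ x => ?_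
  rw [barycenter_extProj hm (mem_of_mem_parts_of_le (hle σ hσ) hC)]

theorem IsTrajectory.convexOn_inertia_extProj (hm : ∀ i, 0 < m i) (hq : IsTrajectory m Tm Tp q)
    {S : Set ℝ} (hS : S.OrdConnected) (hSI : S ⊆ timeInterval Tm Tp) {𝒞 : SetPartition n}
    (hle : ∀ t ∈ S, collPartition (q t) ≤ 𝒞) :
    ConvexOn ℝ S (fun t => inertia m (extProj m 𝒞 (q t))) :=
  hq.convexOn_inertia hm hS hSI (extProjLinear m 𝒞) fun σ hσ x =>
    (extProj_extProj_of_le hm (hle σ hσ) x).trans (extProj_extProj_of_ge hm (hle σ hσ) x).symm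

theorem IsTrajectory.convexOn_inertia_intProj (hm : ∀ i, 0 < m i) (hq : IsTrajectory m Tm Tp q)
    {S : Set ℝ} (hS : S.OrdConnected) (hSI : S ⊆ timeInterval Tm Tp) {𝒞 : SetPartition n}
    (hle : ∀ t ∈ S, collPartition (q t) ≤ 𝒞) :
    ConvexOn ℝ S (fun t => inertia m (intProj m 𝒞 (q t))) :=
  hq.convexOn_inertia hm hS hSI (intProjLinear m 𝒞) fun σ hσ x => intProj_extProj hm (hle σ hσ) x

/-! ### Maximal intervals and the set of collision times -/

/-- The union of all candidates is an interval since they share `τ`; local refinement at `τ`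
supplies one candidate. -/
theorem exists_isGreatest_finerIntervals {I : Set ℝ} (hI : IsOpen I) (τ : ℝ) (hτ : τ ∈ I)
    (h : ∀ᶠ t in 𝓝 τ, collPartition (q t) ≤ collPartition (q τ)) :
    ∃ U, IsGreatest (finerIntervals I q τ) U := by
  obtain ⟨ε, hε, hball⟩ := Metric.eventually_nhds_iff_ball.1 (h.and (hI.mem_nhds hτ))
  refine ⟨⋃₀ finerIntervals I q τ, ⟨isOpen_sUnion fun U hU => hU.1, ?_, ?_, ?_, ?_⟩,
    fun U hU => subset_sUnion_of_mem hU⟩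
  · exact (isPreconnected_sUnion τ _ (fun U hU => hU.2.2.1)
      fun U hU => hU.2.1.isPreconnected).ordConnected
  · refine ⟨Metric.ball τ ε, ⟨Metric.isOpen_ball, (convex_ball τ ε).ordConnected,
      Metric.mem_ball_self hε, fun t ht => (hball t ht).2, fun t ht => (hball t ht).1⟩,
      Metric.mem_ball_self hε⟩
  · exact sUnion_subset fun U hU => hU.2.2.2.1
  · rintro t ⟨U, hU, ht⟩
    exact hU.2.2.2.2 t ht

theorem eq_zero_of_inertia_nonpos (hm : ∀ i, 0 < m i) {x : Config n d} (h : inertia m x ≤ 0) :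
    x = 0 := by
  rw [inertia_eq_sum] at h
  have hnn : ∀ i ∈ Finset.univ, 0 ≤ m i * (1 / 2 * ‖x i‖ ^ 2) := fun i _ =>
    mul_nonneg (hm i).le (by positivity)
  have h0 := (Finset.sum_eq_zero_iff_of_nonneg hnn).1 (le_antisymm h (Finset.sum_nonneg hnn))
  funext i
  simpa [(hm i).ne'] using h0 i (Finset.mem_univ i)

theorem inertia_intProj_eq_zero (hm : ∀ i, 0 < m i) (x : Config n d) :
    inertia m (intProj m (collPartition x) x) = 0 := by
  rw [intProj, extProj_eq_self hm le_rfl, sub_self, inertia_eq_sum]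
  simp

/-- If the collision partition is everywhere finer than `𝒞`, then the set of times where it equals
`𝒞` is an interval. -/
theorem IsTrajectory.collPartition_eq_of_mem_Icc (hm : ∀ i, 0 < m i) (hq : IsTrajectory m Tm Tp q)
    {S : Set ℝ} (hS : S.OrdConnected) (hSI : S ⊆ timeInterval Tm Tp) {𝒞 : SetPartition n}
    (hle : ∀ t ∈ S, collPartition (q t) ≤ 𝒞) {a b t : ℝ} (ha : a ∈ S) (hb : b ∈ S)
    (hqa : collPartition (q a) = 𝒞) (hqb : collPartition (q b) = 𝒞) (ht : t ∈ Icc a b) :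
    collPartition (q t) = 𝒞 := by
  have h := (hq.convexOn_inertia_intProj hm hS hSI hle).le_max_of_mem_Icc ha hb ht
  have h1 := inertia_intProj_eq_zero hm (q a)
  have h2 := inertia_intProj_eq_zero hm (q b)
  rw [hqa] at h1
  rw [hqb] at h2
  simp only [h1, h2, max_self] at h
  have h0 := eq_zero_of_inertia_nonpos hm h
  exact le_antisymm (hle t (hS.out ha hb ht))
    (le_collPartition_of_extProj_eq_self (sub_eq_zero.1 h0).symm)

theorem IsTrajectory.notMem_collTimes_of_mem_Ioo (hm : ∀ i, 0 < m i)
    (hq : IsTrajectory m Tm Tp q)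
    {S : Set ℝ} (hS : S.OrdConnected) (hSI : S ⊆ timeInterval Tm Tp) {𝒞 : SetPartition n}
    (hle : ∀ t ∈ S, collPartition (q t) ≤ 𝒞) {a b t : ℝ} (ha : a ∈ S) (hb : b ∈ S)
    (hqa : collPartition (q a) = 𝒞) (hqb : collPartition (q b) = 𝒞) (ht : t ∈ Ioo a b) :
    t ∉ collTimes (timeInterval Tm Tp) q := fun h => h.2 <| by
  have key : ∀ s ∈ Ioo a b, collPartition (q s) = 𝒞 := fun s hs =>
    hq.collPartition_eq_of_mem_Icc hm hS hSI hle ha hb hqa hqb (Ioo_subset_Icc_self hs)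
  filter_upwards [isOpen_Ioo.mem_nhds ht] with s hs
  rw [key s hs, key t ht]

/-- Local constancy is an open condition, so `𝒯` is relatively closed in `I`. -/
theorem eventually_notMem_collTimes {I : Set ℝ} {τ : ℝ} (hτ : τ ∈ I) (h : τ ∉ collTimes I q) :
    ∀ᶠ t in 𝓝 τ, t ∉ collTimes I q := by
  have h' : ∀ᶠ s in 𝓝 τ, collPartition (q s) = collPartition (q τ) := by
    by_contra hcon
    exact h ⟨hτ, hcon⟩
  filter_upwards [h'.eventually_nhds] with t ht hmem
  refine hmem.2 ?_
  filter_upwards [ht] with s hs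
  rw [hs, ht.self_of_nhds]

/-- Semicontinuity gives `𝒞 ≤ CS(τ)`. If equality held, two points of `𝒯_𝒞` on the same side of `τ`
would put the nearer one strictly between two times with partition `𝒞`, where no collision time can
lie. -/
theorem IsTrajectory.exists_lt_of_accPt (hm : ∀ i, 0 < m i) (hq : IsTrajectory m Tm Tp q)
    (𝒞 : SetPartition n) {τ : ℝ} (hτ : τ ∈ timeInterval Tm Tp)
    (h : AccPt τ (𝓟 (collTimesAt (timeInterval Tm Tp) q 𝒞))) :
    ∃ 𝒟 : SetPartition n, 𝒞 < 𝒟 ∧ τ ∈ collTimesAt (timeInterval Tm Tp) q 𝒟 := by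
  rw [accPt_iff_frequently] at h
  have hmem : τ ∈ collTimes (timeInterval Tm Tp) q := by
    by_contra hcon
    obtain ⟨y, hy, hy'⟩ := (h.and_eventually (eventually_notMem_collTimes hτ hcon)).exists
    exact hy' hy.2.1
  have hle : 𝒞 ≤ collPartition (q τ) := by
    obtain ⟨y, hy, hy'⟩ := (h.and_eventually (hq.eventually_le hτ)).exists
    rwa [← hy.2.2]
  refine ⟨collPartition (q τ), lt_of_le_of_ne hle fun he => ?_, hmem, rfl⟩
  obtain ⟨ε, hε, hball⟩ := Metric.eventually_nhds_iff_ball.1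
    ((hq.eventually_le hτ).and ((isOpen_timeInterval Tm Tp).mem_nhds hτ))
  have hcon := fun {a b t : ℝ} => hq.notMem_collTimes_of_mem_Ioo hm (𝒞 := 𝒞) (a := a) (b := b)
    (t := t) (convex_ball τ ε).ordConnected (fun t ht => (hball t ht).2)
    (fun t ht => he ▸ (hball t ht).1)
  have hself := Metric.mem_ball_self (x := τ) hε
  have hsplit : (∃ᶠ y in 𝓝 τ, τ < y ∧ y ∈ collTimesAt (timeInterval Tm Tp) q 𝒞) ∨
      ∃ᶠ y in 𝓝 τ, y < τ ∧ y ∈ collTimesAt (timeInterval Tm Tp) q 𝒞 := by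
    rw [← frequently_or_distrib]
    refine h.mono fun y hy => ?_
    rcases lt_or_gt_of_ne hy.1 with h1 | h1
    · exact Or.inr ⟨h1, hy.2⟩
    · exact Or.inl ⟨h1, hy.2⟩
  rcases hsplit with h | h
  · obtain ⟨y, ⟨hy, hyC⟩, hyb⟩ := (h.and_eventually (Metric.ball_mem_nhds τ hε)).exists
    obtain ⟨z, ⟨hz, hzC⟩, hzy⟩ := (h.and_eventually (eventually_lt_nhds hy)).exists
    exact hcon hself hyb he.symm hyC.2 ⟨hz, hzy⟩ hzC.1
  · obtain ⟨y, ⟨hy, hyC⟩, hyb⟩ := (h.and_eventually (Metric.ball_mem_nhds τ hε)).exists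
    obtain ⟨z, ⟨hz, hzC⟩, hzy⟩ := (h.and_eventually (eventually_gt_nhds hy)).exists
    exact hcon hyb hself hyC.2 he.symm ⟨hzy, hz⟩ hzC.1

/-- No `𝒯_𝒞` contains an accumulation point of itself, so it is a discrete subset of a hereditarily
Lindelöf space; there are finitely many `𝒞`. -/
theorem IsTrajectory.countable_collTimes (hm : ∀ i, 0 < m i) (hq : IsTrajectory m Tm Tp q) :
    (collTimes (timeInterval Tm Tp) q).Countable := by
  have hfin : Finite (SetPartition n) :=
    Finite.of_injective (fun 𝒞 : SetPartition n => 𝒞.parts) fun _ _ h => Finpartition.ext h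
  have hU : collTimes (timeInterval Tm Tp) q =
      ⋃ 𝒞 : SetPartition n, collTimesAt (timeInterval Tm Tp) q 𝒞 := by
    ext t
    simp [collTimesAt]
  rw [hU]
  refine countable_iUnion fun 𝒞 => ?_
  have hdisc : DiscreteTopology (collTimesAt (timeInterval Tm Tp) q 𝒞) := by
    refine discreteTopology_of_noAccPts fun t ht hacc => ?_
    obtain ⟨𝒟, hlt, h⟩ := hq.exists_lt_of_accPt hm 𝒞 ht.1.1 hacc
    exact hlt.ne (ht.2.symm.trans h.2)
  exact (HereditarilyLindelofSpace.isLindelof _).countable hdisc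

theorem IsTrajectory.isNowhereDense_collTimes (hm : ∀ i, 0 < m i) (hq : IsTrajectory m Tm Tp q) :
    IsNowhereDense (collTimes (timeInterval Tm Tp) q) := by
  by_contra hne
  obtain ⟨x, hx⟩ := nonempty_iff_ne_empty.2 hne
  obtain ⟨y, hy, hyT⟩ := mem_closure_iff.1 (interior_subset hx) _ isOpen_interior hx
  have hO := isOpen_interior (s := closure (collTimes (timeInterval Tm Tp) q)).inter
    (isOpen_timeInterval Tm Tp)
  -- Relative closedness puts this open set inside `𝒯` itself, whose countability rules out interior
  -- points.
  have hsub : interior (closure (collTimes (timeInterval Tm Tp) q)) ∩ timeInterval Tm Tp ⊆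
      collTimes (timeInterval Tm Tp) q := by
    rintro z ⟨hz, hzI⟩
    by_contra hcon
    obtain ⟨w, hw, hwT⟩ := mem_closure_iff_nhds.1 (interior_subset hz) _
      (eventually_notMem_collTimes hzI hcon)
    exact hw hwT
  have := interior_eq_empty_iff_dense_compl.2 ((hq.countable_collTimes hm).dense_compl ℝ)
  exact (this ▸ interior_maximal hsub hO ⟨hy, hyT.1⟩ : y ∈ (∅ : Set ℝ))

/-! ### Bounds on the velocity -/

theorem exists_Icc_subset_of_Icc_subset {S : Set ℝ} (hSo : IsOpen S) (hS : S.OrdConnected)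
    {a b : ℝ} (hle : a ≤ b) (hab : Icc a b ⊆ S) : ∃ δ > 0, Icc (a - δ) (b + δ) ⊆ S := by
  obtain ⟨ε, hε, h1⟩ := Metric.isOpen_iff.1 hSo a (hab (left_mem_Icc.2 hle))
  obtain ⟨ε', hε', h2⟩ := Metric.isOpen_iff.1 hSo b (hab (right_mem_Icc.2 hle))
  have hmin : 0 < min ε ε' := lt_min hε hε'
  refine ⟨min ε ε' / 2, by positivity, hS.out (h1 ?_) (h2 ?_)⟩ <;>
  · rw [Metric.mem_ball, Real.dist_eq]
    ring_nf
    rw [abs_lt]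
    constructor <;> linarith [min_le_left ε ε', min_le_right ε ε']

/-- The external velocities are bounded on compact intervals: the second differences of the convex
functions `t ↦ ∑ j, m j * ‖q j t - c‖` with `c = q i τ` control the velocity of particle `i`. -/
theorem IsTrajectory.exists_extVelocity_bound (hm : ∀ i, 0 < m i) (hq : IsTrajectory m Tm Tp q)
    {a b : ℝ} (hab : Icc a b ⊆ timeInterval Tm Tp) :
    ∃ B, ∀ t ∈ Icc a b, ∀ i, ‖extVelocity m q t i‖ ≤ B := by
  rcases lt_or_ge b a with hlt | hle
  · exact ⟨0, fun t ht => absurd (ht.1.trans ht.2) hlt.not_ge⟩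
  have hIo := isOpen_timeInterval Tm Tp
  have hIc := ordConnected_timeInterval Tm Tp
  obtain ⟨δ, hδ, hK⟩ := exists_Icc_subset_of_Icc_subset hIo hIc hle hab
  obtain ⟨R, hR⟩ := isCompact_Icc.exists_bound_of_continuousOn (hq.continuousOn.mono hK)
  set D := ∑ j, m j * (R + R) with hD
  have hbound : ∀ t ∈ Icc a b, ∀ i, m i * ‖extVelocity m q t i‖ ≤ D / δ := by
    intro t ht i
    set c := q t i with hc
    have htK : t ∈ Icc (a - δ) (b + δ) := ⟨by linarith [ht.1], by linarith [ht.2]⟩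
    have htp : t + δ ∈ Icc (a - δ) (b + δ) := ⟨by linarith [ht.1], by linarith [ht.2]⟩
    have htm : t - δ ∈ Icc (a - δ) (b + δ) := ⟨by linarith [ht.1], by linarith [ht.2]⟩
    have hφ : ConvexOn ℝ univ fun x : EuclideanSpace ℝ (Fin d) => ‖x - c‖ := by
      simpa only [dist_eq_norm] using convexOn_dist c convex_univ
    set Φ : ℝ → ℝ := fun s => ∑ j, m j * ‖q s j - c‖ with hΦ
    have hconv : ConvexOn ℝ (timeInterval Tm Tp) Φ :=
      hq.convexOn_sum_mass hm hIc subset_rfl hφ LinearMap.id fun _ _ _ => rfl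
    have hΦD : ∀ s ∈ Icc (a - δ) (b + δ), Φ s ≤ D := fun s hs => by
      refine Finset.sum_le_sum fun j _ => mul_le_mul_of_nonneg_left ?_ (hm j).le
      exact (norm_sub_le _ _).trans (add_le_add ((norm_le_pi_norm _ j).trans (hR s hs))
        ((norm_le_pi_norm _ i).trans (hR t htK)))
    have hΦ0 : 0 ≤ Φ t := Finset.sum_nonneg fun j _ => mul_nonneg (hm j).le (norm_nonneg _)
    have hev := hq.eventually_extProj_eq hm (hK htK)
    obtain ⟨ε, hε, hball⟩ := Metric.eventually_nhds_iff_ball.1 hev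
    obtain ⟨s, hs0, hs⟩ := exists_between (lt_min hε hδ)
    have hsε := hs.trans_le (min_le_left _ _)
    have hsδ := hs.trans_le (min_le_right _ _)
    have e1 := hball (t + s) (by rw [Metric.mem_ball, Real.dist_eq]; simpa [abs_of_pos hs0])
    have e2 := hball (t - s) (by rw [Metric.mem_ball, Real.dist_eq]; simpa [abs_of_pos hs0])
    set v := extVelocity m q t with hv
    have j1 := sum_mass_convex_extProj_le hm (collPartition (q t)) hφ (q (t + s))
    have j2 := sum_mass_convex_extProj_le hm (collPartition (q t)) hφ (q (t - s))
    rw [e1] at j1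
    rw [e2] at j2
    -- `t ± s` divides the segment from `t` to `t ± δ` in the ratio `s / δ`, so convexity compares
    -- the small scale `s` with the fixed scale `δ`.
    have c0 : 0 ≤ 1 - s / δ := sub_nonneg.2 ((div_le_one hδ).2 hsδ.le)
    have c1 : 0 ≤ s / δ := (div_pos hs0 hδ).le
    have u1 : Φ (t + s) ≤ (1 - s / δ) * Φ t + s / δ * Φ (t + δ) := by
      have := hconv.2 (hK htK) (hK htp) c0 c1 (by ring)
      rwa [show (1 - s / δ) • t + (s / δ) • (t + δ) = t + s by
        simp only [smul_eq_mul]; field_simp; ring] at this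
    have u2 : Φ (t - s) ≤ (1 - s / δ) * Φ t + s / δ * Φ (t - δ) := by
      have := hconv.2 (hK htK) (hK htm) c0 c1 (by ring)
      rwa [show (1 - s / δ) • t + (s / δ) • (t - δ) = t - s by
        simp only [smul_eq_mul]; field_simp; ring] at this
    -- The term `j = i` equals the left side exactly because `c = q t i`; the other terms are
    -- nonnegative by the triangle inequality.
    have l1 : m i * (2 * (s * ‖v i‖)) ≤ ∑ j, m j * (‖q t j + s • v j - c‖ +
        ‖q t j - s • v j - c‖ - 2 * ‖q t j - c‖) := by
      refine le_trans (le_of_eq ?_) (Finset.single_le_sum (f := fun j => m j *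
        (‖q t j + s • v j - c‖ + ‖q t j - s • v j - c‖ - 2 * ‖q t j - c‖))
        (fun j _ => mul_nonneg (hm j).le ?_) (Finset.mem_univ i))
      · simp only [hc, add_sub_cancel_left, sub_sub_cancel_left, sub_self, norm_zero, norm_neg,
          norm_smul, Real.norm_of_nonneg hs0.le]
        ring
      · have := norm_add_le (q t j + s • v j - c) (q t j - s • v j - c)
        rw [show q t j + s • v j - c + (q t j - s • v j - c) = (2 : ℝ) • (q t j - c) by module,
          norm_smul, Real.norm_of_nonneg (by norm_num : (0 : ℝ) ≤ 2)] at this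
        linarith
    have l2 : ∑ j, m j * (‖q t j + s • v j - c‖ + ‖q t j - s • v j - c‖ - 2 * ‖q t j - c‖) ≤
        Φ (t + s) + Φ (t - s) - 2 * Φ t := by
      simp only [Pi.add_apply, Pi.smul_apply, add_sub_cancel_left, sub_sub_cancel_left, neg_smul,
        Pi.neg_apply, ← sub_eq_add_neg] at j1 j2
      change _ ≤ Φ (t + s) at j1
      change _ ≤ Φ (t - s) at j2
      simp only [mul_add, mul_sub, Finset.sum_add_distrib, Finset.sum_sub_distrib]
      have e3 : ∑ j, m j * (2 * ‖q t j - c‖) = 2 * Φ t := by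
        rw [hΦ, Finset.mul_sum]
        exact Finset.sum_congr rfl fun j _ => by ring
      rw [e3]
      linarith
    have l3 : Φ (t + s) + Φ (t - s) - 2 * Φ t ≤ s / δ * (2 * D) := by
      have h1 := mul_le_mul_of_nonneg_left (hΦD _ htp) c1
      have h2 := mul_le_mul_of_nonneg_left (hΦD _ htm) c1
      have h3 := mul_nonneg c1 hΦ0
      linarith
    have l4 := l1.trans (l2.trans l3)
    rw [le_div_iff₀ hδ]
    have l5 : s / δ * (2 * D) * δ = s * (2 * D) := by field_simp
    have l6 := mul_le_mul_of_nonneg_right l4 hδ.le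
    rw [l5] at l6
    nlinarith
  -- The sum over `j` replaces a maximum, giving one bound for all particles; the absolute value
  -- makes every summand nonnegative.
  refine ⟨∑ j, |D / δ| / m j, fun t ht i => ?_⟩
  refine le_trans ?_ (Finset.single_le_sum (f := fun j => |D / δ| / m j)
    (fun j _ => div_nonneg (abs_nonneg _) (hm j).le) (Finset.mem_univ i))
  rw [le_div_iff₀ (hm i), mul_comm]
  exact (hbound t ht i).trans (le_abs_self _)

/-! ### Mass norms, Lipschitz continuity and length -/

theorem massInner_self_eq (m : Fin n → ℝ) (x : Config n d) :
    massInner m x x = ∑ i, m i * ‖x i‖ ^ 2 := by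
  simp only [massInner_eq_sum, real_inner_self_eq_norm_sq]

theorem massInner_self_nonneg (hm : ∀ i, 0 < m i) (x : Config n d) : 0 ≤ massInner m x x := by
  rw [massInner_self_eq]
  exact Finset.sum_nonneg fun i _ => mul_nonneg (hm i).le (sq_nonneg _)

theorem massInner_self_le (hm : ∀ i, 0 < m i) (x : Config n d) :
    massInner m x x ≤ (∑ i, m i) * ‖x‖ ^ 2 := by
  rw [massInner_self_eq, Finset.sum_mul]
  exact Finset.sum_le_sum fun i _ => mul_le_mul_of_nonneg_left
    (pow_le_pow_left₀ (norm_nonneg _) (norm_le_pi_norm x i) 2) (hm i).le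

theorem massNorm_le (hm : ∀ i, 0 < m i) (x : Config n d) :
    massNorm m x ≤ Real.sqrt (∑ i, m i) * ‖x‖ := by
  rw [massNorm, ← Real.sqrt_sq (norm_nonneg x),
    ← Real.sqrt_mul (Finset.sum_nonneg fun i _ => (hm i).le)]
  exact Real.sqrt_le_sqrt (massInner_self_le hm x)

theorem massInner_comm (m : Fin n → ℝ) (x y : Config n d) : massInner m x y = massInner m y x := by
  simp only [massInner_eq_sum, real_inner_comm]

theorem massInner_add_smul (m : Fin n → ℝ) (x v w : Config n d) (c : ℝ) :
    massInner m (x + c • v) w = massInner m x w + c * massInner m v w := by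
  simp only [massInner_eq_sum, Pi.add_apply, Pi.smul_apply, inner_add_left, real_inner_smul_left,
    Finset.mul_sum, ← Finset.sum_add_distrib]
  exact Finset.sum_congr rfl fun i _ => by ring

theorem inertia_add_smul (m : Fin n → ℝ) (x v : Config n d) (c : ℝ) :
    inertia m (x + c • v) = inertia m x + c * massInner m x v + c ^ 2 * inertia m v := by
  rw [inertia, massInner_add_smul, massInner_comm m x, massInner_comm m v, massInner_add_smul,
    massInner_add_smul, massInner_comm m v x, inertia, inertia]
  ring

theorem invMassInner_massMap (hm : ∀ i, 0 < m i) (v : Config n d) :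
    invMassInner m (massMap m v) (massMap m v) = massInner m v v := by
  rw [invMassInner, massInner_eq_sum]
  refine Finset.sum_congr rfl fun i _ => ?_
  have := (hm i).ne'
  simp only [massMap, real_inner_smul_left, real_inner_smul_right]
  field_simp

theorem IsTrajectory.exists_norm_extVelocity_le (hm : ∀ i, 0 < m i) (hq : IsTrajectory m Tm Tp q)
    {a b : ℝ} (hab : Icc a b ⊆ timeInterval Tm Tp) :
    ∃ B, 0 ≤ B ∧ ∀ t ∈ Icc a b, ‖extVelocity m q t‖ ≤ B := by
  obtain ⟨B, hB⟩ := hq.exists_extVelocity_bound hm hab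
  exact ⟨max B 0, le_max_right _ _, fun t ht =>
    (pi_norm_le_iff_of_nonneg (le_max_right _ _)).2 fun i => (hB t ht i).trans (le_max_left _ _)⟩

/-- Off `𝒯` the partition is locally constant, so the external projection is the identity along the
curve near `t`. -/
theorem IsTrajectory.eventually_eq_affine (hm : ∀ i, 0 < m i) (hq : IsTrajectory m Tm Tp q)
    {t : ℝ} (ht : t ∈ timeInterval Tm Tp \ collTimes (timeInterval Tm Tp) q) :
    ∀ᶠ s in 𝓝 t, q s = q t + (s - t) • extVelocity m q t := by
  have h : ∀ᶠ s in 𝓝 t, collPartition (q s) = collPartition (q t) := by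
    by_contra hcon
    exact ht.2 ⟨ht.1, hcon⟩
  filter_upwards [h, hq.eventually_extProj_eq hm ht.1] with s hs he
  rw [← he, extProj_eq_self hm hs.ge]

theorem hasDerivAt_affine (x v : Config n d) (t₀ t : ℝ) :
    HasDerivAt (fun s : ℝ => x + (s - t₀) • v) v t := by
  have := (((hasDerivAt_id t).sub_const t₀).smul_const v).const_add x
  rwa [one_smul] at this

theorem IsTrajectory.hasDerivAt (hm : ∀ i, 0 < m i) (hq : IsTrajectory m Tm Tp q)
    {t : ℝ} (ht : t ∈ timeInterval Tm Tp \ collTimes (timeInterval Tm Tp) q) :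
    HasDerivAt q (extVelocity m q t) t :=
  (hasDerivAt_affine _ _ _ _).congr_of_eventuallyEq (hq.eventually_eq_affine hm ht)

/-- A continuous curve, differentiable off a countable set with bounded derivative, is the integral
of that derivative. -/
theorem IsTrajectory.exists_norm_sub_le (hm : ∀ i, 0 < m i) (hq : IsTrajectory m Tm Tp q)
    {a b : ℝ} (hab : Icc a b ⊆ timeInterval Tm Tp) :
    ∃ B, 0 ≤ B ∧ ∀ s ∈ Icc a b, ∀ t ∈ Icc a b, ‖q t - q s‖ ≤ B * |t - s| := by
  obtain ⟨B, hB0, hB⟩ := hq.exists_norm_extVelocity_le hm hab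
  refine ⟨B, hB0, fun s hs t ht => ?_⟩
  have hst : uIcc s t ⊆ Icc a b := (ordConnected_Icc).uIcc_subset hs ht
  have hcount := hq.countable_collTimes hm
  have hae : ∀ᵐ x, x ∈ uIoc s t → ‖deriv q x‖ ≤ B := by
    filter_upwards [hcount.ae_notMem volume] with x hx hxs
    have hx' := hst (uIoc_subset_uIcc hxs)
    rw [(hq.hasDerivAt hm ⟨hab hx', hx⟩).deriv]
    exact hB x hx'
  have hint : IntervalIntegrable (deriv q) volume s t := by
    rw [intervalIntegrable_iff]
    refine Measure.integrableOn_of_bounded (M := B) measure_Ioc_lt_top.ne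
      (aestronglyMeasurable_deriv q volume) ?_
    exact (ae_restrict_iff' measurableSet_uIoc).2 hae
  rw [← integral_eq_of_hasDerivAt_off_countable q (deriv q) hcount
    (hq.continuousOn.mono (hst.trans hab)) (fun x hx => ?_) hint]
  · exact intervalIntegral.norm_integral_le_of_norm_le_const_ae hae
  · have hxI := hab (hst (Ioo_subset_Icc_self hx.1))
    exact (hq.hasDerivAt hm ⟨hxI, hx.2⟩).differentiableAt.hasDerivAt

theorem sum_fin_succ_sub_castSucc (k : ℕ) (t : Fin (k + 1) → ℝ) :
    ∑ j : Fin k, (t j.succ - t j.castSucc) = t (Fin.last k) - t 0 := by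
  induction k with
  | zero => simp
  | succ k ih =>
    rw [Fin.sum_univ_castSucc]
    have := ih fun j => t j.castSucc
    simp only [Fin.succ_castSucc, Fin.succ_last] at this ⊢
    rw [this, Fin.castSucc_zero]
    ring

theorem IsTrajectory.curveLength_lt_top (hm : ∀ i, 0 < m i) (hq : IsTrajectory m Tm Tp q)
    {a b : ℝ} (hab : Icc a b ⊆ timeInterval Tm Tp) : curveLength m q a b < ⊤ := by
  obtain ⟨B, hB0, hB⟩ := hq.exists_norm_sub_le hm hab
  set K := Real.sqrt (∑ i, m i) * B with hK
  have hK0 : 0 ≤ K := mul_nonneg (Real.sqrt_nonneg _) hB0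
  refine lt_of_le_of_lt (iSup_le fun k => iSup_le fun t => iSup_le fun ht => ?_)
    (ENNReal.ofReal_lt_top (r := K * (b - a)))
  obtain ⟨hmono, h0, h1⟩ := ht
  have hmem : ∀ j, t j ∈ Icc a b := fun j =>
    ⟨h0 ▸ hmono.monotone (Fin.zero_le j), h1 ▸ hmono.monotone (Fin.le_last j)⟩
  have hstep : ∀ j : Fin k, 0 ≤ t j.succ - t j.castSucc := fun j =>
    sub_nonneg.2 (hmono.monotone j.castSucc_lt_succ.le)
  calc ∑ j : Fin k, ENNReal.ofReal (massNorm m (q (t j.succ) - q (t j.castSucc)))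
      ≤ ∑ j : Fin k, ENNReal.ofReal (K * (t j.succ - t j.castSucc)) := by
        refine Finset.sum_le_sum fun j _ => ENNReal.ofReal_le_ofReal ?_
        have := hB _ (hmem j.castSucc) _ (hmem j.succ)
        rw [abs_of_nonneg (hstep j)] at this
        rw [hK, mul_assoc]
        exact (massNorm_le hm _).trans (mul_le_mul_of_nonneg_left this (Real.sqrt_nonneg _))
    _ = ENNReal.ofReal (K * (b - a)) := by
        rw [← ENNReal.ofReal_sum_of_nonneg fun j _ => mul_nonneg hK0 (hstep j), ← Finset.mul_sum,
          sum_fin_succ_sub_castSucc, h0, h1]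

theorem IsTrajectory.exists_massNorm_deriv_le (hm : ∀ i, 0 < m i) (hq : IsTrajectory m Tm Tp q)
    {τ : ℝ} (hτ : τ ∈ timeInterval Tm Tp) :
    ∃ V ∈ 𝓝 τ, ∃ B : ℝ, ∀ t ∈ V ∩ (timeInterval Tm Tp \ collTimes (timeInterval Tm Tp) q),
      massNorm m (deriv q t) ≤ B := by
  obtain ⟨δ, hδ, hK⟩ := exists_Icc_subset_of_Icc_subset (isOpen_timeInterval Tm Tp)
    (ordConnected_timeInterval Tm Tp) le_rfl (Icc_self τ ▸ singleton_subset_iff.2 hτ)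
  obtain ⟨B, -, hB⟩ := hq.exists_norm_extVelocity_le hm hK
  refine ⟨Icc (τ - δ) (τ + δ), Icc_mem_nhds (by linarith) (by linarith),
    Real.sqrt (∑ i, m i) * B, fun t ht => ?_⟩
  rw [(hq.hasDerivAt hm ht.2).deriv]
  exact (massNorm_le hm _).trans (mul_le_mul_of_nonneg_left (hB t ht.1) (Real.sqrt_nonneg _))

/-! ### First derivative of the moment of inertia -/

theorem inertia_eq_extProj_add_intProj (hm : ∀ i, 0 < m i) (𝒟 : SetPartition n) {x : Config n d}
    (hx : x ∈ comSpace m) :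
    inertia m x = inertia m (extProj m 𝒟 x) + inertia m (intProj m 𝒟 x) := by
  have h := inertia_add_smul m (intProj m 𝒟 x) (extProj m 𝒟 x) 1
  rw [extProj_orthogonal hm 𝒟 x (extProj_mem hm 𝒟 hx), one_smul, intProj, sub_add_cancel] at h
  rw [h, intProj]
  ring

/-- The external part of `J` is a quadratic polynomial near `τ` with the stated linear coefficient.
The internal part of `q` vanishes at `τ` and is `O(|t - τ|)` by the Lipschitz bound, so it
contributes only `O((t - τ)²)` to `J`. -/
theorem IsTrajectory.hasDerivAt_inertia (hm : ∀ i, 0 < m i) (hq : IsTrajectory m Tm Tp q)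
    {τ : ℝ} (hτ : τ ∈ timeInterval Tm Tp) :
    HasDerivAt (fun t => inertia m (q t)) (massInner m (q τ) (extVelocity m q τ)) τ := by
  obtain ⟨δ, hδ, hK⟩ := exists_Icc_subset_of_Icc_subset (isOpen_timeInterval Tm Tp)
    (ordConnected_timeInterval Tm Tp) le_rfl (Icc_self τ ▸ singleton_subset_iff.2 hτ)
  obtain ⟨B, hB0, hB⟩ := hq.exists_norm_sub_le hm hK
  set v := extVelocity m q τ with hv
  set D := B + ‖v‖ with hD
  have hM : 0 ≤ ∑ i, m i := Finset.sum_nonneg fun i _ => (hm i).le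
  have hO : (fun t => inertia m (q t) - inertia m (q τ) - (t - τ) • massInner m (q τ) v)
      =O[𝓝 τ] fun t => (t - τ) ^ 2 := by
    refine Asymptotics.IsBigO.of_bound (inertia m v + 1 / 2 * ((∑ i, m i) * D ^ 2)) ?_
    filter_upwards [hq.eventually_extProj_eq hm hτ,
      Icc_mem_nhds (show τ - δ < τ by linarith) (show τ < τ + δ by linarith)] with t ht htI
    have hsplit := inertia_eq_extProj_add_intProj hm (collPartition (q τ)) (hq.mem t (hK htI))
    rw [ht, inertia_add_smul] at hsplit
    have hr : ‖intProj m (collPartition (q τ)) (q t)‖ ≤ D * |t - τ| := by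
      rw [intProj, ht, ← sub_sub, hD, add_mul]
      refine (norm_sub_le _ _).trans (add_le_add (hB τ ?_ t htI) ?_)
      · exact ⟨by linarith, by linarith⟩
      · rw [norm_smul, Real.norm_eq_abs, mul_comm]
    have hr2 : inertia m (intProj m (collPartition (q τ)) (q t)) ≤
        1 / 2 * ((∑ i, m i) * (D ^ 2 * (t - τ) ^ 2)) := by
      refine mul_le_mul_of_nonneg_left ((massInner_self_le hm _).trans
        (mul_le_mul_of_nonneg_left ?_ hM)) (by norm_num)
      rw [← sq_abs (t - τ), ← mul_pow]
      exact pow_le_pow_left₀ (norm_nonneg _) hr 2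
    have hr0 : 0 ≤ inertia m (intProj m (collPartition (q τ)) (q t)) :=
      mul_nonneg (by norm_num) (massInner_self_nonneg hm _)
    have hv0 : 0 ≤ inertia m v := mul_nonneg (by norm_num) (massInner_self_nonneg hm _)
    have he : inertia m (q t) - inertia m (q τ) - (t - τ) • massInner m (q τ) v =
        (t - τ) ^ 2 * inertia m v + inertia m (intProj m (collPartition (q τ)) (q t)) := by
      rw [hsplit, smul_eq_mul]
      ring
    rw [he, Real.norm_of_nonneg (by positivity), Real.norm_of_nonneg (by positivity)]
    linarith
  rw [hasDerivAt_iff_isLittleO]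
  refine hO.trans_isLittleO ?_
  simpa only [Real.norm_eq_abs, sq_abs] using
    Asymptotics.isLittleO_pow_sub_sub τ one_lt_two

/-- The derivative of a differentiable convex function on an open interval is continuous. -/
theorem continuousOn_deriv_of_convexOn {S : Set ℝ} (hSo : IsOpen S) {f : ℝ → ℝ}
    (hf : ConvexOn ℝ S f) (hd : ∀ x ∈ S, DifferentiableAt ℝ f x) : ContinuousOn (deriv f) S := by
  intro x hx
  refine ContinuousAt.continuousWithinAt ?_
  have hmono := hf.monotoneOn_deriv hd
  have hS := hf.1.ordConnected
  obtain ⟨δ, hδ, hK⟩ := exists_Icc_subset_of_Icc_subset hSo hS le_rfl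
    (Icc_self x ▸ singleton_subset_iff.2 hx)
  have hsub : ∀ {a b : ℝ}, a ∈ S → b ∈ S → ∀ y ∈ Icc a b,
      HasDerivWithinAt f (deriv f y) (Icc a b) y := fun ha hb y hy =>
    (hd y (hS.out ha hb hy)).hasDerivAt.hasDerivWithinAt
  refine tendsto_order.2 ⟨fun c hc => ?_, fun c hc => ?_⟩
  · have ha : x - δ ∈ S := hK ⟨le_rfl, by linarith⟩
    -- Either the left endpoint already works, or Darboux's theorem gives a point where the
    -- derivative equals some `c'` between `c` and `deriv f x`. Monotonicity then carries the lower
    -- bound to a neighbourhood of `x`.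
    obtain ⟨y, hyS, hyx, hy⟩ : ∃ y ∈ S, y < x ∧ c < deriv f y := by
      rcases lt_or_ge c (deriv f (x - δ)) with h | h
      · exact ⟨x - δ, ha, by linarith, h⟩
      · obtain ⟨c', hc1, hc2⟩ := exists_between hc
        obtain ⟨y, hy, hyc⟩ := exists_hasDerivWithinAt_eq_of_gt_of_lt (by linarith)
          (hsub ha hx) (h.trans_lt hc1) hc2
        exact ⟨y, hS.out ha hx (Ioo_subset_Icc_self hy), hy.2, hyc ▸ hc1⟩
    filter_upwards [hSo.mem_nhds hx, eventually_gt_nhds hyx] with z hz hyz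
    exact hy.trans_le (hmono hyS hz hyz.le)
  · have hb : x + δ ∈ S := hK ⟨by linarith, le_rfl⟩
    obtain ⟨y, hyS, hyx, hy⟩ : ∃ y ∈ S, x < y ∧ deriv f y < c := by
      rcases lt_or_ge (deriv f (x + δ)) c with h | h
      · exact ⟨x + δ, hb, by linarith, h⟩
      · obtain ⟨c', hc1, hc2⟩ := exists_between hc
        obtain ⟨y, hy, hyc⟩ := exists_hasDerivWithinAt_eq_of_gt_of_lt (by linarith)
          (hsub hx hb) hc1 (hc2.trans_le h)
        exact ⟨y, hS.out hx hb (Ioo_subset_Icc_self hy), hy.1, hyc ▸ hc2⟩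
    filter_upwards [hSo.mem_nhds hx, eventually_lt_nhds hyx] with z hz hyz
    exact (hmono hz hyS hyz.le).trans_lt hy

/-! ### Distributional derivatives -/

theorem setIntegral_eq_intervalIntegral {I : Set ℝ} (hI : MeasurableSet I) {a b : ℝ} (hab : a ≤ b)
    (hsub : Icc a b ⊆ I) {f : ℝ → ℝ} (hf : ∀ x ∉ Ioc a b, f x = 0) :
    ∫ x in I, f x = ∫ x in a..b, f x := by
  rw [intervalIntegral.integral_of_le hab]
  exact setIntegral_eq_of_subset_of_forall_sdiff_eq_zero hI (Ioc_subset_Icc_self.trans hsub)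
    fun x hx => hf x hx.2

theorem exists_tsupport_subset_Ioo {I : Set ℝ} (hIo : IsOpen I) (hI : I.OrdConnected)
    (hne : I.Nonempty) {φ : ℝ → ℝ} (hφ : HasCompactSupport φ) (hφI : tsupport φ ⊆ I) :
    ∃ a b, a < b ∧ Icc a b ⊆ I ∧ tsupport φ ⊆ Ioo a b := by
  obtain ⟨a, b, hab, hsub, hs⟩ : ∃ a b, a ≤ b ∧ Icc a b ⊆ I ∧ tsupport φ ⊆ Icc a b := by
    rcases (tsupport φ).eq_empty_or_nonempty with h | h
    · obtain ⟨x, hx⟩ := hne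
      exact ⟨x, x, le_rfl, by simpa using hx, by simp [h]⟩
    · obtain ⟨a, ha⟩ := hφ.isCompact.exists_isLeast h
      obtain ⟨b, hb⟩ := hφ.isCompact.exists_isGreatest h
      exact ⟨a, b, ha.2 hb.1, hI.out (hφI ha.1) (hφI hb.1), fun x hx => ⟨ha.2 hx, hb.2 hx⟩⟩
  obtain ⟨δ, hδ, hK⟩ := exists_Icc_subset_of_Icc_subset hIo hI hab hsub
  exact ⟨a - δ, b + δ, by linarith, hK, fun x hx =>
    ⟨by linarith [(hs hx).1], by linarith [(hs hx).2]⟩⟩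

/-- A continuous function which is differentiable off a countable set, with a nonnegative derivative
that is integrable on compact intervals, has this derivative as its distributional derivative. -/
theorem hasDistribDerivMeasure_of_hasDerivAt_off_countable {I : Set ℝ} (hIo : IsOpen I)
    (hI : I.OrdConnected) {T : Set ℝ} (hT : T.Countable) {f k : ℝ → ℝ} (hf : ContinuousOn f I)
    (hd : ∀ t ∈ I \ T, HasDerivAt f (k t) t) (hk0 : ∀ t, 0 ≤ k t)
    (hk : LocallyIntegrableOn k I volume) :
    HasDistribDerivMeasure I f
      ((volume.restrict I).withDensity fun t => ENNReal.ofReal (k t)) := by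
  have hmeas := hIo.measurableSet
  refine ⟨hf.locallyIntegrableOn hmeas, fun K hKI hK => ?_, fun φ hφ hφc hφI => ?_⟩
  · rw [withDensity_apply _ hK.measurableSet, Measure.restrict_restrict hK.measurableSet,
      inter_eq_self_of_subset_left hKI]
    exact (hk.integrableOn_compact_subset hKI hK).lintegral_lt_top
  · have hkm : AEMeasurable k (volume.restrict I) := hk.aestronglyMeasurable.aemeasurable
    rw [integral_withDensity_eq_integral_toReal_smul₀ hkm.ennreal_ofReal
      (Eventually.of_forall fun t => ENNReal.ofReal_lt_top)]
    simp only [ENNReal.toReal_ofReal (hk0 _), smul_eq_mul]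
    rcases I.eq_empty_or_nonempty with rfl | hne
    · simp
    obtain ⟨a, b, hab, hsub, hsupp⟩ := exists_tsupport_subset_Ioo hIo hI hne hφc hφI
    have hφ0 : ∀ x ∉ Ioo a b, φ x = 0 := fun x hx => image_eq_zero_of_notMem_tsupport
      fun h => hx (hsupp h)
    have hφ0' : ∀ x ∉ Ioc a b, φ x = 0 := fun x hx => hφ0 x fun h => hx (Ioo_subset_Ioc_self h)
    have hdφ0 : ∀ x ∉ Ioc a b, deriv φ x = 0 := fun x hx => by
      by_contra hne
      exact hx (Ioo_subset_Ioc_self (hsupp (support_deriv_subset hne)))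
    rw [setIntegral_eq_intervalIntegral hmeas hab.le hsub fun x hx => by rw [hφ0' x hx, mul_zero],
      setIntegral_eq_intervalIntegral hmeas hab.le hsub fun x hx => by rw [hdφ0 x hx, mul_zero]]
    have hdφ : Continuous (deriv φ) := hφ.continuous_deriv (by simp)
    have i1 : IntervalIntegrable (fun x => k x * φ x) volume a b := by
      refine IntervalIntegrable.mul_continuousOn ?_ hφ.continuous.continuousOn
      rw [intervalIntegrable_iff_integrableOn_Icc_of_le hab.le]
      exact hk.integrableOn_compact_subset hsub isCompact_Icc
    have i2 : IntervalIntegrable (fun x => f x * deriv φ x) volume a b := by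
      refine ContinuousOn.intervalIntegrable ?_
      rw [uIcc_of_le hab.le]
      exact (hf.mono hsub).mul hdφ.continuousOn
    -- Integration by parts for `f * φ`; the boundary terms vanish because the support of `φ` lies
    -- in the open interval.
    have h := integral_eq_of_hasDerivAt_off_countable_of_le (fun x => f x * φ x)
      (fun x => k x * φ x + f x * deriv φ x) hab.le hT
      ((hf.mono hsub).mul hφ.continuous.continuousOn)
      (fun x hx => (hd x ⟨hsub (Ioo_subset_Icc_self hx.1), hx.2⟩).mul
        (hφ.differentiable (by simp) x).hasDerivAt) (i1.add i2)
    rw [intervalIntegral.integral_add i1 i2, hφ0 a (by simp), hφ0 b (by simp)] at h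
    linarith

/-! ### Second derivative of the moment of inertia -/

theorem IsTrajectory.convexOn_inertia_comp (hm : ∀ i, 0 < m i) (hq : IsTrajectory m Tm Tp q) :
    ConvexOn ℝ (timeInterval Tm Tp) fun t => inertia m (q t) :=
  hq.convexOn_inertia hm (ordConnected_timeInterval Tm Tp) subset_rfl LinearMap.id
    fun _ _ _ => rfl

theorem IsTrajectory.continuousOn_deriv_inertia (hm : ∀ i, 0 < m i)
    (hq : IsTrajectory m Tm Tp q) :
    ContinuousOn (deriv fun t => inertia m (q t)) (timeInterval Tm Tp) :=
  continuousOn_deriv_of_convexOn (isOpen_timeInterval Tm Tp) (hq.convexOn_inertia_comp hm)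
    fun _ ht => (hq.hasDerivAt_inertia hm ht).differentiableAt

theorem IsTrajectory.contDiffOn_inertia (hm : ∀ i, 0 < m i) (hq : IsTrajectory m Tm Tp q) :
    ContDiffOn ℝ 1 (fun t => inertia m (q t)) (timeInterval Tm Tp) := by
  have h := (contDiffOn_succ_iff_deriv_of_isOpen (n := 0) (𝕜 := ℝ)
    (f := fun t => inertia m (q t)) (isOpen_timeInterval Tm Tp)).2
    ⟨fun t ht => (hq.hasDerivAt_inertia hm ht).differentiableAt.differentiableWithinAt,
      by simp, contDiffOn_zero.2 (hq.continuousOn_deriv_inertia hm)⟩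
  simpa using h

theorem IsTrajectory.hasDerivAt_deriv_inertia (hm : ∀ i, 0 < m i) (hq : IsTrajectory m Tm Tp q)
    {t : ℝ} (ht : t ∈ timeInterval Tm Tp \ collTimes (timeInterval Tm Tp) q) :
    HasDerivAt (deriv fun s => inertia m (q s))
      (invMassInner m (extMomentumCS m q t) (extMomentumCS m q t)) t := by
  rw [extMomentumCS_eq, invMassInner_massMap hm]
  set v := extVelocity m q t
  have hev : (deriv fun s => inertia m (q s)) =ᶠ[𝓝 t]
      fun s => massInner m (q t) v + (s - t) * massInner m v v := by
    filter_upwards [(hq.eventually_eq_affine hm ht).eventually_nhds,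
      eventually_notMem_collTimes ht.1 ht.2, (isOpen_timeInterval Tm Tp).mem_nhds ht.1]
      with s hs hsT hsI
    -- Near a non-collision time `q` is a single affine curve, so the external velocity is constant
    -- there by uniqueness of derivatives.
    have hvs : extVelocity m q s = v := (hq.hasDerivAt hm ⟨hsI, hsT⟩).unique
      ((hasDerivAt_affine (q t) v t s).congr_of_eventuallyEq hs)
    rw [(hq.hasDerivAt_inertia hm hsI).deriv, hvs, hs.self_of_nhds, massInner_add_smul]
  refine HasDerivAt.congr_of_eventuallyEq ?_ hev
  have := (((hasDerivAt_id t).sub_const t).mul_const (massInner m v v)).const_add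
    (massInner m (q t) v)
  rwa [one_mul] at this

theorem IsTrajectory.locallyIntegrableOn_invMassInner (hm : ∀ i, 0 < m i)
    (hq : IsTrajectory m Tm Tp q) :
    LocallyIntegrableOn (fun t => invMassInner m (extMomentumCS m q t) (extMomentumCS m q t))
      (timeInterval Tm Tp) volume := by
  intro τ hτ
  obtain ⟨δ, hδ, hK⟩ := exists_Icc_subset_of_Icc_subset (isOpen_timeInterval Tm Tp)
    (ordConnected_timeInterval Tm Tp) le_rfl (Icc_self τ ▸ singleton_subset_iff.2 hτ)
  refine ⟨Icc (τ - δ) (τ + δ), mem_nhdsWithin_of_mem_nhds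
    (Icc_mem_nhds (by linarith) (by linarith)), ?_⟩
  obtain ⟨B, hB0, hB⟩ := hq.exists_norm_extVelocity_le hm hK
  have hM : 0 ≤ ∑ i, m i := Finset.sum_nonneg fun i _ => (hm i).le
  refine Integrable.of_bound (μ := volume.restrict (Icc (τ - δ) (τ + δ))) ?_
    ((∑ i, m i) * B ^ 2) ?_
  · refine (aestronglyMeasurable_deriv (deriv fun s => inertia m (q s)) _).congr ?_
    filter_upwards [ae_restrict_of_ae ((hq.countable_collTimes hm).ae_notMem volume),
      ae_restrict_mem measurableSet_Icc] with t ht htK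
    exact (hq.hasDerivAt_deriv_inertia hm ⟨hK htK, ht⟩).deriv
  · filter_upwards [ae_restrict_mem measurableSet_Icc] with t htK
    rw [extMomentumCS_eq, invMassInner_massMap hm, Real.norm_of_nonneg (massInner_self_nonneg hm _)]
    exact (massInner_self_le hm _).trans (mul_le_mul_of_nonneg_left
      (pow_le_pow_left₀ (norm_nonneg _) (hB t htK) 2) hM)

end NDSystem

open NDSystem
theorem theorem3p6 {n d : ℕ} (m : Fin n → ℝ) (hm : ∀ i, 0 < m i) (Tm Tp : EReal)
    (q : ℝ → Config n d) (hq : IsTrajectory m Tm Tp q) (I : Set ℝ) (hI : I = timeInterval Tm Tp) :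
    -- maximal intervals, and convexity of the cluster parts on them
    (∀ τ ∈ I, ∃ U : Set ℝ, IsGreatest (finerIntervals I q τ) U ∧
      (∀ C ∈ (collPartition (q τ)).parts,
        ConvexOn ℝ U (fun t => inertia m (clusterExtProj m C (q t))) ∧
        ConvexOn ℝ U (fun t => clusterMass m C / 2 * ‖barycenter m C (q t)‖ ^ 2) ∧
        ConvexOn ℝ U (fun t => inertia m (clusterIntProj m C (q t)))) ∧
      ConvexOn ℝ U (fun t => inertia m (extProj m (collPartition (q τ)) (q t))) ∧
      ConvexOn ℝ U (fun t => inertia m (intProj m (collPartition (q τ)) (q t)))) ∧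
    -- convexity of the moment of inertia
    ConvexOn ℝ I (fun t => inertia m (q t)) ∧
    -- the collision times
    (∀ (𝒞 : SetPartition n), ∀ τ ∈ I, AccPt τ (𝓟 (collTimesAt I q 𝒞)) →
      ∃ 𝒟 : SetPartition n, 𝒞 < 𝒟 ∧ τ ∈ collTimesAt I q 𝒟) ∧
    (collTimes I q).Countable ∧ IsNowhereDense (collTimes I q) ∧
    -- the velocity is locally bounded, and the curve has finite length on compact intervals
    (∀ t ∈ I \ collTimes I q, DifferentiableAt ℝ q t) ∧
    (∀ τ ∈ I, ∃ V ∈ 𝓝 τ, ∃ B : ℝ, ∀ t ∈ V ∩ (I \ collTimes I q), massNorm m (deriv q t) ≤ B) ∧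
    (∀ a b : ℝ, a ≤ b → Icc a b ⊆ I → curveLength m q a b < ⊤) ∧
    -- the first derivative of the moment of inertia
    ContDiffOn ℝ 1 (fun t => inertia m (q t)) I ∧
    (∀ t ∈ I, HasDerivAt (fun s => inertia m (q s)) (pairing (q t) (extMomentumCS m q t)) t) ∧
    -- the second derivative of the moment of inertia
    (∀ t ∈ I, deriv (fun s => inertia m (q s)) t =
      pairing (extProj m (collPartition (q t)) (q t)) (extMomentumCS m q t)) ∧
    LocallyIntegrableOn (fun t => invMassInner m (extMomentumCS m q t) (extMomentumCS m q t))
      I volume ∧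
    HasDistribDerivMeasure I (deriv (fun s => inertia m (q s)))
      ((volume.restrict I).withDensity fun t =>
        ENNReal.ofReal (invMassInner m (extMomentumCS m q t) (extMomentumCS m q t))) := by
  subst hI
  have hIo := isOpen_timeInterval Tm Tp
  refine ⟨fun τ hτ => ?_, hq.convexOn_inertia_comp hm,
    fun 𝒞 τ hτ => hq.exists_lt_of_accPt hm 𝒞 hτ, hq.countable_collTimes hm,
    hq.isNowhereDense_collTimes hm, fun t ht => (hq.hasDerivAt hm ht).differentiableAt,
    fun τ hτ => hq.exists_massNorm_deriv_le hm hτ, fun a b _ hab => hq.curveLength_lt_top hm hab,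
    hq.contDiffOn_inertia hm, fun t ht => hq.hasDerivAt_inertia hm ht, fun t ht => ?_,
    hq.locallyIntegrableOn_invMassInner hm, ?_⟩
  · obtain ⟨U, hU⟩ := exists_isGreatest_finerIntervals hIo τ hτ (hq.eventually_le hτ)
    obtain ⟨-, hUc, -, hUI, hle⟩ := hU.1
    exact ⟨U, hU, fun C hC => hq.convexOn_cluster hm hUc hUI hle hC,
      hq.convexOn_inertia_extProj hm hUc hUI hle, hq.convexOn_inertia_intProj hm hUc hUI hle⟩
  · rw [extProj_eq_self hm le_rfl]
    exact (hq.hasDerivAt_inertia hm ht).deriv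
  · refine hasDistribDerivMeasure_of_hasDerivAt_off_countable hIo
      (ordConnected_timeInterval Tm Tp) (hq.countable_collTimes hm)
      (hq.continuousOn_deriv_inertia hm) (fun t ht => hq.hasDerivAt_deriv_inertia hm ht)
      (fun t => ?_) (hq.locallyIntegrableOn_invMassInner hm)
    rw [extMomentumCS_eq, invMassInner_massMap hm]
    exact massInner_self_nonneg hm _
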